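/- **Lemma (Virtual upper bound).** Let $m_1=m_1(n)$ and $m_2=m_2(n)$ be proportional to $n$, i.e. $m_1/n\to\alpha_1$ and $m_2/n\to\alpha_2$ with constants $\alpha_1,\alpha_2$ independent of $n$ (for instance $m_i=\alpha_i n$ for those $n$ for which these are integers). For each $n$ let $A\in\mathbb R^{m_1\times n}$ and $B\in\mathbb R^{m_2\times n}$ be random matrices all of whose entries are i.i.d. standard normal, let $g\in\mathbb R^n$ be a random vector with i.i.d. standard normal entries, and let $f=f_n:\mathbb R^n\to\mathbb R$ be a given function. Events $E_n$ hold *with overwhelming probability* if there is a constant $c>0$, independent of $n$, with $P(E_n)\ge 1-e^{-cn}$ for all large $n$. Let $$\xi(f,A,B)=\inf\{f(x): x\in\mathbb R^n,\ Ax=0,\ Bx\le 0\}\in[-\infty,\infty].$$ Assume that, with overwhelming probability, $|\xi(f,A,B)|<\infty$ and that, with overwhelming probability, strong duality holds: $$\xi(f,A,B)=\inf_{x}\ \sup_{\lambda\ge0,\ \nu}\bigl(f(x)+\nu^TAx+\lambda^TBx\bigr)=\sup_{\lambda\ge0,\ \nu}\ \inf_{x}\bigl(f(x)+\nu^TAx+\lambda^TBx\bigr),$$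 where $\nu\in\mathbb R^{m_1}$ and $\lambda\in\mathbb R^{m_2}$. Let $\varepsilon_1,\varepsilon_5>0$ be arbitrary constants independent of $n$, let $\xi_D^{(u)}(f)=\xi_D^{(u)}(f_n)\in\mathbb R$, and put $$U^{(1)}=\inf\Bigl\{f(x)-\xi_D^{(u)}(f):\ x\in\mathbb R^n,\ -g^Tx+\|x\|_2\bigl((1+\varepsilon_1)\sqrt{m_1+m_2/2}+\varepsilon_5\sqrt n\bigr)\le0\Bigr\}.$$ If the scalars $\xi_D^{(u)}(f)$ are such that $U^{(1)}\le 0$ with overwhelming probability (in particular, if they are the smallest such scalars), then $$\lim_{n\to\infty}P\bigl(\xi(f,A,B)\le\xi_D^{(u)}(f)\bigr)=1.$$ If moreover $U^{(1)}<0$ with overwhelming probability, then $$\lim_{n\to\infty}P\bigl(\xi(f,A,B)<\xi_D^{(u)}(f)\bigr)=1.$$ -/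

import Mathlib

open MeasureTheory ProbabilityTheory Filter Topology Matrix

noncomputable section

namespace RandomDuality

/-- The law of a vector with `n` i.i.d. standard normal components. -/
def gaussianVector (n : ℕ) : Measure (Fin n → ℝ) :=
  Measure.pi fun _ => gaussianReal 0 1

/-- The law of an `m × n` matrix with i.i.d. standard normal components, given by its
rows (turned into a `Matrix` by `Matrix.of`). -/
def gaussianMatrix (m n : ℕ) : Measure (Fin m → Fin n → ℝ) :=
  Measure.pi fun _ => Measure.pi fun _ => gaussianReal 0 1

/-- The joint law of `(A, B)` when all components of the `m₁ × n` matrix `A` and of the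
`m₂ × n` matrix `B` are i.i.d. standard normal. -/
def gaussianPair (m₁ m₂ n : ℕ) :
    Measure ((Fin m₁ → Fin n → ℝ) × (Fin m₂ → Fin n → ℝ)) :=
  (gaussianMatrix m₁ n).prod (gaussianMatrix m₂ n)

/-- The events `E n` hold with overwhelming probability: the probability of failure is at most
`exp (-c n)` for all large `n`, with a constant `c > 0` independent of `n`. -/
def WithOverwhelmingProbability {Ω : ℕ → Type} [∀ n, MeasurableSpace (Ω n)]
    (P : ∀ n, Measure (Ω n)) (E : ∀ n, Set (Ω n)) : Prop :=
  ∃ c : ℝ, 0 < c ∧ ∀ᶠ n : ℕ in atTop, P n (E n)ᶜ ≤ ENNReal.ofReal (Real.exp (-(c * n)))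

/-- The optimal value `ξ(f, A, B)` of: minimize `f x` subject to `A x = 0` and `B x ≤ 0`. -/
def optValue {m₁ m₂ n : ℕ} (f : EuclideanSpace ℝ (Fin n) → ℝ)
    (A : Matrix (Fin m₁) (Fin n) ℝ) (B : Matrix (Fin m₂) (Fin n) ℝ) : EReal :=
  ⨅ (x : EuclideanSpace ℝ (Fin n)) (_ : A *ᵥ x.ofLp = 0 ∧ B *ᵥ x.ofLp ≤ 0), (f x : EReal)

/-- The Lagrangian `f x + νᵀ A x + lᵀ B x`. -/
def lagrangian {m₁ m₂ n : ℕ} (f : EuclideanSpace ℝ (Fin n) → ℝ)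
    (A : Matrix (Fin m₁) (Fin n) ℝ) (B : Matrix (Fin m₂) (Fin n) ℝ)
    (x : EuclideanSpace ℝ (Fin n)) (ν : Fin m₁ → ℝ) (l : Fin m₂ → ℝ) : ℝ :=
  f x + ν ⬝ᵥ (A *ᵥ x.ofLp) + l ⬝ᵥ (B *ᵥ x.ofLp)

/-- Strong duality: `ξ(f, A, B)` is the min-max and also the max-min of the Lagrangian, the
multipliers `l` of the inequality constraints being nonnegative. -/
def StrongDuality {m₁ m₂ n : ℕ} (f : EuclideanSpace ℝ (Fin n) → ℝ)
    (A : Matrix (Fin m₁) (Fin n) ℝ) (B : Matrix (Fin m₂) (Fin n) ℝ) : Prop :=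
  optValue f A B =
      ⨅ x : EuclideanSpace ℝ (Fin n), ⨆ (ν : Fin m₁ → ℝ) (l : Fin m₂ → ℝ) (_ : 0 ≤ l),
        (lagrangian f A B x ν l : EReal) ∧
  optValue f A B =
      ⨆ (ν : Fin m₁ → ℝ) (l : Fin m₂ → ℝ) (_ : 0 ≤ l), ⨅ x : EuclideanSpace ℝ (Fin n),
        (lagrangian f A B x ν l : EReal)

/-- The optimal value `U⁽¹⁾` of the auxiliary program with level `t`: minimize `f x - t` subject to
`-gᵀ x + ‖x‖ ((1 + ε₁) √(m₁ + m₂ / 2) + ε₅ √n) ≤ 0`. -/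
def auxValue {n : ℕ} (m₁ m₂ : ℕ) (ε₁ ε₅ : ℝ) (f : EuclideanSpace ℝ (Fin n) → ℝ) (t : ℝ)
    (g : Fin n → ℝ) : EReal :=
  ⨅ (x : EuclideanSpace ℝ (Fin n))
    (_ : -(g ⬝ᵥ x.ofLp) +
      ‖x‖ * ((1 + ε₁) * √((m₁ : ℝ) + (m₂ : ℝ) / 2) + ε₅ * √(n : ℝ)) ≤ 0),
    ((f x - t : ℝ) : EReal)

end RandomDuality

end

/-!
Write `C` for the matrix with row blocks `A` and `B`. If strong duality holds and `ξ(f, A, B) > t`,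
then some multiplier `y = (ν, λ)` with `λ ≥ 0` satisfies `f x + yᵀ C x > t` for all `x`. By Gordon's
comparison inequality, the Gaussian process `yᵀ C x + ‖x‖ ‖y‖ g₀` may be replaced in such a
max-min event by `‖x‖ hᵀ y - ‖y‖ gᵀ x`, with `g` and `h` standard Gaussian vectors; restricting to
`g₀ > 0` removes the extra term at the cost of a constant factor. For `λ ≥ 0`, `hᵀ y` is at most
`‖y‖` times the norm of the projection of `h` onto the dual cone, and by Chebyshev's inequality that
norm exceeds `√(m₁ + m₂ / 2)` by `ε₅ √n / 2` only with vanishing probability. Outside this event,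
`f > t` at every feasible point of the auxiliary program, which is excluded when `U⁽¹⁾ < 0`, and
also when `U⁽¹⁾ ≤ 0` if `t` exceeds the level of that program.
-/

namespace RandomDuality

section Stein

open scoped NNReal

lemma hasDerivAt_gaussianPDFReal (μ : ℝ) (v : ℝ≥0) (x : ℝ) :
    HasDerivAt (gaussianPDFReal μ v) (-((x - μ) / v * gaussianPDFReal μ v x)) x := by
  have hexponent : HasDerivAt (fun y : ℝ => -(y - μ) ^ 2 / (2 * v)) (-((x - μ) / v)) x := by
    convert! (((hasDerivAt_id x).sub_const μ).pow 2).neg.div_const (2 * (v : ℝ)) using 1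
    simp only [id]
    rcases eq_or_ne (v : ℝ) 0 with hv | hv
    · simp [hv]
    · field_simp
      ring
  convert! hexponent.exp.const_mul (√(2 * Real.pi * v))⁻¹ using 1
  rw [gaussianPDFReal]
  ring

lemma integrable_gaussianReal_iff {μ : ℝ} {v : ℝ≥0} (hv : v ≠ 0) {u : ℝ → ℝ} :
    Integrable u (gaussianReal μ v) ↔ Integrable fun x => u x * gaussianPDFReal μ v x := by
  rw [gaussianReal_of_var_ne_zero _ hv, integrable_withDensity_iff (measurable_gaussianPDF _ _)
    (ae_of_all _ fun _ => gaussianPDF_lt_top)]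
  simp only [toReal_gaussianPDF]

theorem integral_sub_mul_gaussianReal {μ : ℝ} {v : ℝ≥0} {u u' : ℝ → ℝ}
    (hu : ∀ x, HasDerivAt u (u' x) x) (hi : Integrable u (gaussianReal μ v))
    (hi' : Integrable u' (gaussianReal μ v))
    (him : Integrable (fun x => (x - μ) * u x) (gaussianReal μ v)) :
    ∫ x, (x - μ) * u x ∂gaussianReal μ v = v * ∫ x, u' x ∂gaussianReal μ v := by
  rcases eq_or_ne v 0 with rfl | hv
  · simp
  have hv' : (v : ℝ) ≠ 0 := by simpa using hv
  rw [integrable_gaussianReal_iff hv] at hi hi' him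
  have hparts := integral_mul_deriv_eq_deriv_mul_of_integrable (u := u) (u' := u')
    (v := gaussianPDFReal μ v) (fun x _ => hu x) (fun x _ => hasDerivAt_gaussianPDFReal μ v x)
    ((him.const_mul (-(v : ℝ)⁻¹)).congr (ae_of_all _ fun x => by simp only [Pi.mul_apply]; ring))
    hi' hi
  rw [integral_gaussianReal_eq_integral_smul hv, integral_gaussianReal_eq_integral_smul hv]
  simp only [smul_eq_mul]
  calc ∫ x, gaussianPDFReal μ v x * ((x - μ) * u x)
      = -v * ∫ x, u x * -((x - μ) / v * gaussianPDFReal μ v x) := by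
        rw [← integral_const_mul]
        exact integral_congr_ae (ae_of_all _ fun x => by field_simp)
    _ = v * ∫ x, gaussianPDFReal μ v x * u' x := by
        rw [hparts]
        simp only [mul_comm (gaussianPDFReal μ v _)]
        ring

end Stein

section Resampling

variable {κ : Type*} [Fintype κ] [DecidableEq κ] {X : κ → Type*} [∀ i, MeasurableSpace (X i)]
  (μ : ∀ i, Measure (X i)) [∀ i, IsProbabilityMeasure (μ i)]

lemma measurePreserving_update (a : κ) :
    MeasurePreserving (fun z : (∀ i, X i) × X a => Function.update z.1 a z.2)
      ((Measure.pi μ).prod (μ a)) (Measure.pi μ) := by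
  refine ⟨measurable_update', (Measure.pi_eq fun s hs => ?_).symm⟩
  have hpre : (fun z : (∀ i, X i) × X a => Function.update z.1 a z.2) ⁻¹' Set.univ.pi s =
      Set.univ.pi (Function.update s a Set.univ) ×ˢ s a := by
    ext z
    simp only [Set.mem_preimage, Set.mem_univ_pi, Set.mem_prod,
      Function.forall_update_iff z.1 (fun i t => t ∈ s i),
      Function.forall_update_iff s (fun i t => z.1 i ∈ t), Set.mem_univ, true_and, and_comm]
  rw [Measure.map_apply measurable_update' (MeasurableSet.univ_pi hs), hpre, Measure.prod_prod,
    Measure.pi_pi]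
  simp only [Function.apply_update (fun i => μ i), measure_univ,
    Finset.prod_update_of_mem (Finset.mem_univ a), one_mul]
  rw [Finset.sdiff_singleton_eq_erase, Finset.prod_erase_mul _ _ (Finset.mem_univ a)]

lemma integral_pi_eq_integral_update {E : Type*} [NormedAddCommGroup E] [NormedSpace ℝ E] (a : κ)
    {v : (∀ i, X i) → E} (hv : Integrable v (Measure.pi μ)) :
    ∫ w, v w ∂Measure.pi μ = ∫ w, ∫ t, v (Function.update w a t) ∂μ a ∂Measure.pi μ := by
  have hmp := measurePreserving_update μ a
  calc ∫ w, v w ∂Measure.pi μ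
      = ∫ z, v (Function.update z.1 a z.2) ∂(Measure.pi μ).prod (μ a) := by
        rw [← integral_map hmp.aemeasurable (by rw [hmp.map_eq]; exact hv.1), hmp.map_eq]
    _ = _ := integral_prod _ (hmp.integrable_comp_of_integrable hv)

end Resampling

section BoundedC1

variable {E E' : Type*} [NormedAddCommGroup E] [NormedSpace ℝ E] [NormedAddCommGroup E']
  [NormedSpace ℝ E']

/-- Continuously differentiable real functions that are bounded together with their derivative:
the class of test functions for which Gaussian integration by parts is applied. -/
structure BoundedC1 (u : E → ℝ) : Prop where
  contDiff : ContDiff ℝ 1 u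
  bounded : ∃ K, ∀ x, |u x| ≤ K
  bounded_fderiv : ∃ K, ∀ x, ‖fderiv ℝ u x‖ ≤ K

namespace BoundedC1

variable {u v : E → ℝ}

lemma hasFDerivAt (hu : BoundedC1 u) (x : E) : HasFDerivAt u (fderiv ℝ u x) x :=
  (hu.contDiff.differentiable one_ne_zero x).hasFDerivAt

lemma comp_clm {u : E' → ℝ} (hu : BoundedC1 u) (L : E →L[ℝ] E') :
    BoundedC1 fun x => u (L x) := by
  obtain ⟨K, hK⟩ := hu.bounded
  obtain ⟨K', hK'⟩ := hu.bounded_fderiv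
  refine ⟨hu.contDiff.comp L.contDiff, ⟨K, fun x => hK _⟩, K' * ‖L‖, fun x => ?_⟩
  have hderiv : HasFDerivAt (fun x => u (L x)) (fderiv ℝ u (L x) ∘L L) x :=
    (hu.hasFDerivAt (L x)).comp x L.hasFDerivAt
  rw [hderiv.fderiv]
  exact (ContinuousLinearMap.opNorm_comp_le _ _).trans (by gcongr; exact hK' _)

lemma comp_sub_const (hu : BoundedC1 u) (c : E) : BoundedC1 fun x => u (x - c) := by
  obtain ⟨K, hK⟩ := hu.bounded
  obtain ⟨K', hK'⟩ := hu.bounded_fderiv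
  refine ⟨hu.contDiff.comp (contDiff_id.sub contDiff_const), ⟨K, fun x => hK _⟩, K', fun x => ?_⟩
  rw [fderiv_comp_sub]
  exact hK' _

lemma const (c : ℝ) : BoundedC1 fun _ : E => c :=
  ⟨contDiff_const, ⟨|c|, fun _ => le_rfl⟩, 0, fun x => by simp⟩

lemma const_sub (hu : BoundedC1 u) (c : ℝ) : BoundedC1 fun x => c - u x := by
  obtain ⟨K, hK⟩ := hu.bounded
  obtain ⟨K', hK'⟩ := hu.bounded_fderiv
  exact ⟨contDiff_const.sub hu.contDiff,
    ⟨|c| + K, fun x => (abs_sub _ _).trans (by gcongr; exact hK x)⟩, K',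
    fun x => by simpa [fderiv_const_sub] using hK' x⟩

lemma mul (hu : BoundedC1 u) (hv : BoundedC1 v) : BoundedC1 fun x => u x * v x := by
  obtain ⟨K, hK⟩ := hu.bounded
  obtain ⟨K', hK'⟩ := hu.bounded_fderiv
  obtain ⟨L, hL⟩ := hv.bounded
  obtain ⟨L', hL'⟩ := hv.bounded_fderiv
  refine ⟨hu.contDiff.mul hv.contDiff, ⟨K * L, fun x => ?_⟩, K * L' + L * K', fun x => ?_⟩
  · rw [abs_mul]
    exact mul_le_mul (hK x) (hL x) (abs_nonneg _) ((abs_nonneg _).trans (hK x))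
  · rw [fderiv_fun_mul (hu.hasFDerivAt x).differentiableAt (hv.hasFDerivAt x).differentiableAt]
    refine (norm_add_le _ _).trans ?_
    rw [norm_smul, norm_smul]
    exact add_le_add
      (mul_le_mul (hK x) (hL' x) (norm_nonneg _) ((abs_nonneg _).trans (hK x)))
      (mul_le_mul (hL x) (hK' x) (norm_nonneg _) ((abs_nonneg _).trans (hL x)))

lemma prod {ι : Type*} (s : Finset ι) {u : ι → E → ℝ} (hu : ∀ i, BoundedC1 (u i)) :
    BoundedC1 fun x => ∏ i ∈ s, u i x := by
  classical
  induction s using Finset.induction_on with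
  | empty => simpa using const 1
  | insert i s hi ih => simpa only [Finset.prod_insert hi] using (hu i).mul ih

end BoundedC1

end BoundedC1

section PartialDerivatives

variable {P : Type*} [Fintype P] [DecidableEq P]

/-- The partial derivative `∂u/∂z_p`, as a function of the point `z`. -/
noncomputable def partialDeriv (p : P) (u : (P → ℝ) → ℝ) (z : P → ℝ) : ℝ :=
  fderiv ℝ u z (Pi.single p 1)

lemma fderiv_apply_eq_sum_partialDeriv (u : (P → ℝ) → ℝ) (z v : P → ℝ) :
    fderiv ℝ u z v = ∑ p, v p * partialDeriv p u z := by
  conv_lhs => rw [pi_eq_sum_univ' v]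
  simp [partialDeriv, Pi.single]

namespace BoundedC1

variable {u : (P → ℝ) → ℝ}

lemma continuous_partialDeriv (hu : BoundedC1 u) (p : P) : Continuous (partialDeriv p u) :=
  (hu.contDiff.continuous_fderiv one_ne_zero).clm_apply continuous_const

lemma bounded_partialDeriv (hu : BoundedC1 u) (p : P) : ∃ K, ∀ z, |partialDeriv p u z| ≤ K := by
  obtain ⟨K, hK⟩ := hu.bounded_fderiv
  refine ⟨K, fun z => ((fderiv ℝ u z).le_opNorm _).trans ?_⟩
  rw [Pi.norm_single, norm_one, mul_one]
  exact hK z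

lemma hasDerivAt_comp_update (hu : BoundedC1 u) (z : P → ℝ) (p : P) (t : ℝ) :
    HasDerivAt (fun t => u (Function.update z p t)) (partialDeriv p u (Function.update z p t)) t :=
  (hu.hasFDerivAt _).comp_hasDerivAt t (hasDerivAt_update z p t)

end BoundedC1

end PartialDerivatives

section GaussianVectors

/-- The law of a family of i.i.d. standard normal variables indexed by the finite type `κ`. -/
noncomputable abbrev stdGaussianPi (κ : Type*) [Fintype κ] : Measure (κ → ℝ) :=
  Measure.pi fun _ => gaussianReal 0 1

variable {κ : Type*} [Fintype κ]

lemma integrable_coord_stdGaussianPi (a : κ) :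
    Integrable (fun w : κ → ℝ => w a) (stdGaussianPi κ) :=
  (measurePreserving_eval (fun _ : κ => gaussianReal 0 1) a).integrable_comp_of_integrable
    ((memLp_id_gaussianReal 1).integrable le_rfl)

lemma integrable_coord_mul_stdGaussianPi (a : κ) {u : (κ → ℝ) → ℝ} (hc : Continuous u)
    (hb : ∃ K, ∀ w, |u w| ≤ K) : Integrable (fun w => w a * u w) (stdGaussianPi κ) :=
  (integrable_coord_stdGaussianPi a).mul_bdd hc.aestronglyMeasurable (ae_of_all _ hb.choose_spec)

lemma integrable_of_continuous_of_bounded {Ω : Type*} [TopologicalSpace Ω] [MeasurableSpace Ω]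
    [OpensMeasurableSpace Ω] {μ : Measure Ω} [IsFiniteMeasure μ] {u : Ω → ℝ} (hc : Continuous u)
    (hb : ∃ K, ∀ w, |u w| ≤ K) : Integrable u μ :=
  Integrable.of_bound hc.aestronglyMeasurable _ (ae_of_all _ hb.choose_spec)

theorem BoundedC1.integral_coord_mul [DecidableEq κ] {u : (κ → ℝ) → ℝ} (hu : BoundedC1 u) (a : κ) :
    ∫ w, w a * u w ∂stdGaussianPi κ = ∫ w, partialDeriv a u w ∂stdGaussianPi κ := by
  have hcoord := integrable_coord_mul_stdGaussianPi a hu.contDiff.continuous hu.bounded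
  have hderiv : Integrable (partialDeriv a u) (stdGaussianPi κ) :=
    integrable_of_continuous_of_bounded (hu.continuous_partialDeriv a) (hu.bounded_partialDeriv a)
  rw [integral_pi_eq_integral_update _ a hcoord, integral_pi_eq_integral_update _ a hderiv]
  congr with w
  have hupd : Continuous (Function.update w a) := continuous_const.update a continuous_id
  have hslice : Integrable (fun t => u (Function.update w a t)) (gaussianReal 0 1) :=
    integrable_of_continuous_of_bounded (hu.contDiff.continuous.comp hupd)
      (hu.bounded.imp fun _ hK t => hK _)
  have hslice' :
      Integrable (fun t => partialDeriv a u (Function.update w a t)) (gaussianReal 0 1) :=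
    integrable_of_continuous_of_bounded ((hu.continuous_partialDeriv a).comp hupd)
      ((hu.bounded_partialDeriv a).imp fun _ hK t => hK _)
  have hslice_mul : Integrable (fun t => t * u (Function.update w a t)) (gaussianReal 0 1) :=
    ((memLp_id_gaussianReal 1).integrable le_rfl).mul_bdd hslice.1
      (ae_of_all _ fun t => hu.bounded.choose_spec _)
  simpa using integral_sub_mul_gaussianReal (fun t => hu.hasDerivAt_comp_update w a t) hslice
    hslice' (by simpa using hslice_mul)

end GaussianVectors

section Interpolation

variable {κ P : Type*} [Fintype κ] [Fintype P]

lemma integrable_mulVec_stdGaussianPi (L : Matrix P κ ℝ) :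
    Integrable (fun w => L *ᵥ w) (stdGaussianPi κ) :=
  (LinearMap.toContinuousLinearMap L.mulVecLin).integrable_comp
    (Integrable.of_eval integrable_coord_stdGaussianPi)

namespace BoundedC1

variable {u : (P → ℝ) → ℝ}

lemma comp_mulVec (hu : BoundedC1 u) (L : Matrix P κ ℝ) : BoundedC1 fun w => u (L *ᵥ w) :=
  hu.comp_clm (LinearMap.toContinuousLinearMap L.mulVecLin)

lemma integrable_comp_mulVec (hu : BoundedC1 u) (L : Matrix P κ ℝ) :
    Integrable (fun w => u (L *ᵥ w)) (stdGaussianPi κ) :=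
  integrable_of_continuous_of_bounded (hu.comp_mulVec L).contDiff.continuous
    (hu.comp_mulVec L).bounded

variable [DecidableEq P]

lemma partialDeriv_comp_mulVec [DecidableEq κ] (hu : BoundedC1 u) (L : Matrix P κ ℝ) (a : κ)
    (w : κ → ℝ) :
    partialDeriv a (fun w => u (L *ᵥ w)) w = ∑ q, L q a * partialDeriv q u (L *ᵥ w) := by
  have hderiv : HasFDerivAt (fun w => u (L *ᵥ w))
      (fderiv ℝ u (L *ᵥ w) ∘L LinearMap.toContinuousLinearMap L.mulVecLin) w :=
    (hu.hasFDerivAt (L *ᵥ w)).comp w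
      (LinearMap.toContinuousLinearMap L.mulVecLin).hasFDerivAt
  rw [partialDeriv, hderiv.fderiv, ContinuousLinearMap.comp_apply,
    fderiv_apply_eq_sum_partialDeriv]
  simp

lemma integral_coord_mul_comp_mulVec (hu : BoundedC1 u) (L : Matrix P κ ℝ) (a : κ) :
    ∫ w, w a * u (L *ᵥ w) ∂stdGaussianPi κ =
      ∑ q, L q a * ∫ w, partialDeriv q u (L *ᵥ w) ∂stdGaussianPi κ := by
  classical
  have hint (q : P) : Integrable (fun w => partialDeriv q u (L *ᵥ w)) (stdGaussianPi κ) :=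
    integrable_of_continuous_of_bounded
      ((hu.continuous_partialDeriv q).comp (by fun_prop : Continuous fun w => L *ᵥ w))
      ((hu.bounded_partialDeriv q).imp fun _ hK w => hK _)
  rw [(hu.comp_mulVec L).integral_coord_mul a]
  simp only [hu.partialDeriv_comp_mulVec, integral_finsetSum _ fun q _ => (hint q).const_mul _,
    integral_const_mul]

end BoundedC1

lemma integral_fderiv_mulVec_apply_mulVec [DecidableEq P] {F : (P → ℝ) → ℝ}
    (hF : ∀ p, BoundedC1 (partialDeriv p F)) (L L' : Matrix P κ ℝ) :
    ∫ w, fderiv ℝ F (L *ᵥ w) (L' *ᵥ w) ∂stdGaussianPi κ =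
      ∑ p, ∑ q, (L' * Lᵀ) p q *
        ∫ w, partialDeriv q (partialDeriv p F) (L *ᵥ w) ∂stdGaussianPi κ := by
  have hint (p : P) (a : κ) :
      Integrable (fun w => L' p a * (w a * partialDeriv p F (L *ᵥ w))) (stdGaussianPi κ) :=
    (integrable_coord_mul_stdGaussianPi a ((hF p).comp_mulVec L).contDiff.continuous
      ((hF p).comp_mulVec L).bounded).const_mul _
  have hexpand (w : κ → ℝ) : fderiv ℝ F (L *ᵥ w) (L' *ᵥ w) =
      ∑ p, ∑ a, L' p a * (w a * partialDeriv p F (L *ᵥ w)) := by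
    simp only [fderiv_apply_eq_sum_partialDeriv, Matrix.mulVec_eq_sum, Finset.sum_apply,
      Pi.smul_apply, Matrix.transpose_apply, MulOpposite.smul_eq_mul_unop, MulOpposite.unop_op,
      Finset.sum_mul, mul_assoc]
  simp only [hexpand]
  rw [integral_finsetSum _ fun p _ => integrable_finsetSum _ fun a _ => hint p a]
  refine Finset.sum_congr rfl fun p _ => ?_
  simp only [integral_finsetSum _ fun a _ => hint p a, integral_const_mul,
    (hF p).integral_coord_mul_comp_mulVec, Finset.mul_sum, Matrix.mul_apply, Finset.sum_mul,
    Matrix.transpose_apply, mul_assoc]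
  exact Finset.sum_comm

/-- The path of matrices along which the Gaussian vectors `N w` and `M w` are interpolated: it runs
from `N` at `θ = 0` to `M` at `θ = π / 2`, and its derivative is its value at `θ + π / 2`. -/
noncomputable def interpolationPath (M N : Matrix P κ ℝ) (θ : ℝ) : Matrix P κ ℝ :=
  Real.sin θ • M + Real.cos θ • N

variable {M N : Matrix P κ ℝ}

omit [Fintype P] in
lemma interpolationPath_mulVec (θ : ℝ) (w : κ → ℝ) :
    interpolationPath M N θ *ᵥ w = Real.sin θ • (M *ᵥ w) + Real.cos θ • (N *ᵥ w) := by
  simp only [interpolationPath, Matrix.add_mulVec, Matrix.smul_mulVec]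

lemma norm_interpolationPath_mulVec_le (θ : ℝ) (w : κ → ℝ) :
    ‖interpolationPath M N θ *ᵥ w‖ ≤ ‖M *ᵥ w‖ + ‖N *ᵥ w‖ := by
  rw [interpolationPath_mulVec]
  refine (norm_add_le _ _).trans ?_
  rw [norm_smul, norm_smul]
  exact add_le_add (mul_le_of_le_one_left (norm_nonneg _) (Real.abs_sin_le_one θ))
    (mul_le_of_le_one_left (norm_nonneg _) (Real.abs_cos_le_one θ))

omit [Fintype P] in
lemma hasDerivAt_interpolationPath_mulVec [Finite P] (θ : ℝ) (w : κ → ℝ) :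
    HasDerivAt (fun θ => interpolationPath M N θ *ᵥ w)
      (interpolationPath M N (θ + Real.pi / 2) *ᵥ w) θ := by
  cases nonempty_fintype P
  simp only [interpolationPath_mulVec, Real.sin_add_pi_div_two, Real.cos_add_pi_div_two]
  exact ((Real.hasDerivAt_sin θ).smul_const _).add ((Real.hasDerivAt_cos θ).smul_const _)

omit [Fintype P] in
lemma interpolationPath_mul_transpose (hMN : M * Nᵀ = 0) (θ : ℝ) :
    interpolationPath M N (θ + Real.pi / 2) * (interpolationPath M N θ)ᵀ =
      (Real.sin θ * Real.cos θ) • (M * Mᵀ - N * Nᵀ) := by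
  have hNM : N * Mᵀ = 0 := by simpa using congrArg Matrix.transpose hMN
  simp only [interpolationPath, Real.sin_add_pi_div_two, Real.cos_add_pi_div_two,
    Matrix.transpose_add, Matrix.transpose_smul, Matrix.add_mul, Matrix.mul_add, Matrix.smul_mul,
    Matrix.mul_smul, hMN, hNM]
  module

lemma hasDerivAt_integral_interpolationPath {F : (P → ℝ) → ℝ} (hF : BoundedC1 F) (θ : ℝ) :
    HasDerivAt (fun θ => ∫ w, F (interpolationPath M N θ *ᵥ w) ∂stdGaussianPi κ)
      (∫ w, fderiv ℝ F (interpolationPath M N θ *ᵥ w)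
        (interpolationPath M N (θ + Real.pi / 2) *ᵥ w) ∂stdGaussianPi κ) θ := by
  obtain ⟨K, hK⟩ := hF.bounded_fderiv
  have hcont (θ : ℝ) : Continuous fun w => fderiv ℝ F (interpolationPath M N θ *ᵥ w)
      (interpolationPath M N (θ + Real.pi / 2) *ᵥ w) :=
    ((hF.contDiff.continuous_fderiv one_ne_zero).comp
      (by fun_prop : Continuous fun w => interpolationPath M N θ *ᵥ w)).clm_apply (by fun_prop)
  refine (hasDerivAt_integral_of_dominated_loc_of_deriv_le
    (bound := fun w => K * (‖M *ᵥ w‖ + ‖N *ᵥ w‖)) univ_mem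
    (Eventually.of_forall fun θ => (hF.integrable_comp_mulVec _).1) (hF.integrable_comp_mulVec _)
    (hcont θ).aestronglyMeasurable (ae_of_all _ fun w θ _ => ?_) ?_
    (ae_of_all _ fun w θ _ => (hF.hasFDerivAt _).comp_hasDerivAt θ
      (hasDerivAt_interpolationPath_mulVec θ w))).2
  · refine ((fderiv ℝ F _).le_opNorm _).trans ?_
    exact mul_le_mul (hK _) (norm_interpolationPath_mulVec_le _ w) (norm_nonneg _)
      ((norm_nonneg _).trans (hK 0))
  · exact ((integrable_mulVec_stdGaussianPi M).norm.add
      (integrable_mulVec_stdGaussianPi N).norm).const_mul K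

theorem integral_mulVec_le_integral_mulVec [DecidableEq P] {F : (P → ℝ) → ℝ}
    (hF : BoundedC1 F) (hF' : ∀ p, BoundedC1 (partialDeriv p F)) (hMN : M * Nᵀ = 0)
    (hsign : ∀ p q z,
      0 ≤ ((M * Mᵀ) p q - (N * Nᵀ) p q) * partialDeriv q (partialDeriv p F) z) :
    ∫ w, F (N *ᵥ w) ∂stdGaussianPi κ ≤ ∫ w, F (M *ᵥ w) ∂stdGaussianPi κ := by
  have hderiv := hasDerivAt_integral_interpolationPath (M := M) (N := N) hF
  have hmono : MonotoneOn (fun θ => ∫ w, F (interpolationPath M N θ *ᵥ w) ∂stdGaussianPi κ)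
      (Set.Icc 0 (Real.pi / 2)) := by
    refine monotoneOn_of_hasDerivWithinAt_nonneg (convex_Icc _ _)
      (fun θ _ => (hderiv θ).continuousAt.continuousWithinAt)
      (fun θ _ => (hderiv θ).hasDerivWithinAt) fun θ hθ => ?_
    rw [interior_Icc] at hθ
    have hsin : 0 ≤ Real.sin θ :=
      Real.sin_nonneg_of_nonneg_of_le_pi hθ.1.le (by linarith [hθ.2, Real.pi_pos])
    have hcos : 0 ≤ Real.cos θ :=
      Real.cos_nonneg_of_neg_pi_div_two_le_of_le (by linarith [hθ.1, Real.pi_pos]) hθ.2.le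
    rw [integral_fderiv_mulVec_apply_mulVec hF', interpolationPath_mul_transpose hMN]
    refine Finset.sum_nonneg fun p _ => Finset.sum_nonneg fun q _ => ?_
    rw [Matrix.smul_apply, Matrix.sub_apply, smul_eq_mul, mul_assoc, ← integral_const_mul]
    exact mul_nonneg (mul_nonneg hsin hcos) (integral_nonneg fun w => hsign p q _)
  have hpi : (0 : ℝ) ≤ Real.pi / 2 := by positivity
  simpa [interpolationPath] using
    hmono (Set.left_mem_Icc.2 hpi) (Set.right_mem_Icc.2 hpi) hpi

end Interpolation

section SmoothTransition

lemma deriv_smoothTransition_of_notMem_Icc {x : ℝ} (hx : x ∉ Set.Icc (0 : ℝ) 1) :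
    deriv Real.smoothTransition x = 0 := by
  rcases not_and_or.1 hx with hx | hx
  · have hzero : Real.smoothTransition =ᶠ[𝓝 x] fun _ => 0 := by
      filter_upwards [gt_mem_nhds (not_le.1 hx)] with y hy
      exact Real.smoothTransition.zero_of_nonpos hy.le
    rw [hzero.deriv_eq, deriv_const]
  · have hone : Real.smoothTransition =ᶠ[𝓝 x] fun _ => 1 := by
      filter_upwards [lt_mem_nhds (not_le.1 hx)] with y hy
      exact Real.smoothTransition.one_of_one_le hy.le
    rw [hone.deriv_eq, deriv_const]

lemma boundedC1_deriv_smoothTransition : BoundedC1 (deriv Real.smoothTransition) := by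
  have hsmooth : ContDiff ℝ 1 (deriv Real.smoothTransition) :=
    (contDiff_succ_iff_deriv (n := 1).1 (Real.smoothTransition.contDiff (n := 2))).2.2
  have hsupport : HasCompactSupport (deriv Real.smoothTransition) :=
    HasCompactSupport.intro isCompact_Icc fun x hx => deriv_smoothTransition_of_notMem_Icc hx
  exact ⟨hsmooth, hsupport.exists_bound_of_continuous hsmooth.continuous,
    (hsupport.fderiv (𝕜 := ℝ)).exists_bound_of_continuous
      (hsmooth.continuous_fderiv one_ne_zero)⟩

lemma boundedC1_smoothTransition : BoundedC1 Real.smoothTransition := by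
  obtain ⟨K, hK⟩ := boundedC1_deriv_smoothTransition.bounded
  refine ⟨Real.smoothTransition.contDiff (n := 1), ⟨1, fun x => ?_⟩, K, fun x => ?_⟩
  · rw [abs_of_nonneg (Real.smoothTransition.nonneg x)]
    exact Real.smoothTransition.le_one x
  · rw [← norm_deriv_eq_norm_fderiv]
    exact hK x

end SmoothTransition

section BlockFun

variable {I J : Type*} [Fintype I] [Fintype J]

/-- Gordon's comparison functional on arrays `z` with rows indexed by `I`: if the `ψ (i, j)` are
smoothed indicators of `(l (i, j), ∞)`, this is a smoothed indicator of the event that in every row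
some entry stays below its threshold. -/
noncomputable def blockFun (ψ : I × J → ℝ → ℝ) (z : I × J → ℝ) : ℝ :=
  ∏ i, (1 - ∏ j, ψ (i, j) (z (i, j)))

lemma BoundedC1.comp_coord {P : Type*} [Fintype P] {u : ℝ → ℝ} (hu : BoundedC1 u) (p : P) :
    BoundedC1 fun z : P → ℝ => u (z p) :=
  hu.comp_clm (ContinuousLinearMap.proj (R := ℝ) (φ := fun _ : P => ℝ) p)

variable {ψ : I × J → ℝ → ℝ}

lemma boundedC1_blockFun (hψ : ∀ p, BoundedC1 (ψ p)) : BoundedC1 (blockFun ψ) :=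
  BoundedC1.prod _ fun i => (BoundedC1.prod _ fun j => (hψ (i, j)).comp_coord (i, j)).const_sub 1

variable [DecidableEq I] [DecidableEq J]

lemma blockFun_update (z : I × J → ℝ) (p : I × J) (t : ℝ) :
    blockFun ψ (Function.update z p t) =
      (∏ i ∈ Finset.univ.erase p.1, (1 - ∏ j, ψ (i, j) (z (i, j)))) *
        (1 - (∏ j ∈ Finset.univ.erase p.2, ψ (p.1, j) (z (p.1, j))) * ψ p t) := by
  rw [blockFun, ← Finset.prod_erase_mul _ _ (Finset.mem_univ p.1),
    ← Finset.prod_erase_mul Finset.univ (fun j => ψ (p.1, j) _) (Finset.mem_univ p.2), Prod.mk.eta,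
    Function.update_self]
  congr 1
  · refine Finset.prod_congr rfl fun i hi => ?_
    have hne (j : J) : (i, j) ≠ p := fun h => Finset.ne_of_mem_erase hi (congrArg Prod.fst h)
    simp only [Function.update_of_ne (hne _)]
  · congr 2
    refine Finset.prod_congr rfl fun j hj => ?_
    have hne : (p.1, j) ≠ p := fun h => Finset.ne_of_mem_erase hj (congrArg Prod.snd h)
    rw [Function.update_of_ne hne]

lemma partialDeriv_blockFun (hψ : ∀ p, BoundedC1 (ψ p)) (p : I × J) (z : I × J → ℝ) :
    partialDeriv p (blockFun ψ) z =
      (0 - ∏ i ∈ Finset.univ.erase p.1, (1 - ∏ j, ψ (i, j) (z (i, j)))) *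
        (deriv (ψ p) (z p) * ∏ j ∈ Finset.univ.erase p.2, ψ (p.1, j) (z (p.1, j))) := by
  have hfactored := (boundedC1_blockFun hψ).hasDerivAt_comp_update z p (z p)
  simp only [blockFun_update, Function.update_eq_self] at hfactored
  have hψp : HasDerivAt (ψ p) (deriv (ψ p) (z p)) (z p) :=
    ((hψ p).hasFDerivAt (z p)).differentiableAt.hasDerivAt
  rw [hfactored.unique (((hψp.const_mul _).const_sub 1).const_mul _)]
  ring

lemma boundedC1_partialDeriv_blockFun (hψ : ∀ p, BoundedC1 (ψ p))
    (hψ' : ∀ p, BoundedC1 (deriv (ψ p))) (p : I × J) :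
    BoundedC1 (partialDeriv p (blockFun ψ)) := by
  rw [funext (partialDeriv_blockFun hψ p)]
  exact ((BoundedC1.prod _ fun i => (BoundedC1.prod _ fun j =>
    (hψ (i, j)).comp_coord (i, j)).const_sub 1).const_sub 0).mul
    (((hψ' p).comp_coord p).mul (BoundedC1.prod _ fun j => (hψ (p.1, j)).comp_coord (p.1, j)))

lemma monotone_partialDeriv_blockFun_update (hψ : ∀ p, BoundedC1 (ψ p))
    (hmono : ∀ p, Monotone (ψ p)) (hIcc : ∀ p t, ψ p t ∈ Set.Icc (0 : ℝ) 1) {p q : I × J}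
    (hpq : p.1 ≠ q.1) (z : I × J → ℝ) :
    Monotone fun t => partialDeriv p (blockFun ψ) (Function.update z q t) := by
  intro s t hst
  have hp : p ≠ q := fun h => hpq (congrArg Prod.fst h)
  have hpj (j : J) : (p.1, j) ≠ q := fun h => hpq (h ▸ rfl)
  have h0 (p : I × J) (t : ℝ) : 0 ≤ ψ p t := (hIcc p t).1
  have h1 (p : I × J) (t : ℝ) : ψ p t ≤ 1 := (hIcc p t).2
  simp only [partialDeriv_blockFun hψ, Function.update_of_ne hp, Function.update_of_ne (hpj _)]
  refine mul_le_mul_of_nonneg_right (sub_le_sub_left (Finset.prod_le_prod (fun i _ => ?_)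
    fun i _ => sub_le_sub_left (Finset.prod_le_prod (fun _ _ => h0 _ _) fun j _ => ?_) _) _)
    (mul_nonneg (hmono p).deriv_nonneg (Finset.prod_nonneg fun _ _ => h0 _ _))
  · exact sub_nonneg.2 (Finset.prod_le_one (fun _ _ => h0 _ _) fun _ _ => h1 _ _)
  · exact hmono _ (update_le_update_iff.2 ⟨hst, fun _ _ => le_rfl⟩ (i, j))

lemma partialDeriv_partialDeriv_blockFun_nonneg (hψ : ∀ p, BoundedC1 (ψ p))
    (hψ' : ∀ p, BoundedC1 (deriv (ψ p))) (hmono : ∀ p, Monotone (ψ p))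
    (hIcc : ∀ p t, ψ p t ∈ Set.Icc (0 : ℝ) 1) {p q : I × J} (hpq : p.1 ≠ q.1) (z : I × J → ℝ) :
    0 ≤ partialDeriv q (partialDeriv p (blockFun ψ)) z := by
  have hderiv := (boundedC1_partialDeriv_blockFun hψ hψ' p).hasDerivAt_comp_update z q (z q)
  rw [Function.update_eq_self] at hderiv
  rw [← hderiv.deriv]
  exact (monotone_partialDeriv_blockFun_update hψ hmono hIcc hpq z).deriv_nonneg

omit [DecidableEq I] [DecidableEq J] in
theorem integral_blockFun_mulVec_le {κ : Type*} [Fintype κ]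
    {M N : Matrix (I × J) κ ℝ} (hψ : ∀ p, BoundedC1 (ψ p)) (hψ' : ∀ p, BoundedC1 (deriv (ψ p)))
    (hmono : ∀ p, Monotone (ψ p)) (hIcc : ∀ p t, ψ p t ∈ Set.Icc (0 : ℝ) 1) (hMN : M * Nᵀ = 0)
    (hblock : ∀ i j k, (M * Mᵀ) (i, j) (i, k) = (N * Nᵀ) (i, j) (i, k))
    (hcov : ∀ p q, (N * Nᵀ) p q ≤ (M * Mᵀ) p q) :
    ∫ w, blockFun ψ (N *ᵥ w) ∂stdGaussianPi κ ≤ ∫ w, blockFun ψ (M *ᵥ w) ∂stdGaussianPi κ := by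
  classical
  refine integral_mulVec_le_integral_mulVec (boundedC1_blockFun hψ)
    (boundedC1_partialDeriv_blockFun hψ hψ') hMN fun p q z => ?_
  by_cases hpq : p.1 = q.1
  · have heq : (M * Mᵀ) p q = (N * Nᵀ) p q := by
      have hrow := hblock p.1 p.2 q.2
      rwa [Prod.mk.eta, hpq, Prod.mk.eta] at hrow
    rw [heq, sub_self, zero_mul]
  · exact mul_nonneg (sub_nonneg.2 (hcov p q))
      (partialDeriv_partialDeriv_blockFun_nonneg hψ hψ' hmono hIcc hpq z)

end BlockFun

section Gordon

variable {I J : Type*}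

/-- The arrays in which all the entries of some row exceed their thresholds `l (i, j)`. -/
def rowExceedance (l : I × J → ℝ) : Set (I × J → ℝ) :=
  {z | ∃ i, ∀ j, l (i, j) < z (i, j)}

lemma measurableSet_rowExceedance [Countable I] [Countable J] (l : I × J → ℝ) :
    MeasurableSet (rowExceedance l) := by
  simp only [rowExceedance, Set.ofPred_exists, Set.ofPred_forall]
  exact .iUnion fun i => .iInter fun j => measurableSet_lt measurable_const (measurable_pi_apply _)

lemma indicator_rowExceedance_le_one_sub_blockFun [Fintype I] [Fintype J] {ψ : I × J → ℝ → ℝ}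
    {u : I × J → ℝ} (hIcc : ∀ p t, ψ p t ∈ Set.Icc (0 : ℝ) 1) (hone : ∀ p t, u p < t → ψ p t = 1)
    (z : I × J → ℝ) : (rowExceedance u).indicator 1 z ≤ 1 - blockFun ψ z := by
  refine Set.indicator_le' (g := fun z => 1 - blockFun ψ z) (fun z hz => ?_) (fun z _ => ?_) z
  · obtain ⟨i, hi⟩ := hz
    have hrow : 1 - ∏ j, ψ (i, j) (z (i, j)) = 0 := by
      rw [Finset.prod_eq_one fun j _ => hone _ _ (hi j), sub_self]
    rw [blockFun, Finset.prod_eq_zero (Finset.mem_univ i) hrow, sub_zero, Pi.one_apply]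
  · refine sub_nonneg.2 (Finset.prod_le_one (fun i _ => sub_nonneg.2 ?_)
      fun i _ => sub_le_self _ ?_)
    · exact Finset.prod_le_one (fun j _ => (hIcc _ _).1) fun j _ => (hIcc _ _).2
    · exact Finset.prod_nonneg fun j _ => (hIcc _ _).1

lemma one_sub_blockFun_le_indicator_rowExceedance [Fintype I] [Fintype J] {ψ : I × J → ℝ → ℝ}
    {l : I × J → ℝ} (hIcc : ∀ p t, ψ p t ∈ Set.Icc (0 : ℝ) 1) (hzero : ∀ p t, t ≤ l p → ψ p t = 0)
    (z : I × J → ℝ) : 1 - blockFun ψ z ≤ (rowExceedance l).indicator 1 z := by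
  refine Set.le_indicator (fun z _ => sub_le_self _ ?_) (fun z hz => ?_) z
  · exact Finset.prod_nonneg fun i _ => sub_nonneg.2
      (Finset.prod_le_one (fun j _ => (hIcc _ _).1) fun j _ => (hIcc _ _).2)
  · simp only [rowExceedance, Set.mem_ofPred_eq, not_exists, not_forall, not_lt] at hz
    refine (sub_eq_zero.2 (Finset.prod_eq_one fun i _ => ?_).symm).le
    obtain ⟨j, hj⟩ := hz i
    rw [Finset.prod_eq_zero (Finset.mem_univ j) (hzero _ _ hj), sub_zero]

variable {κ κ' : Type*} [Fintype κ] [Fintype κ']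

lemma measurableSet_preimage_mulVec_rowExceedance [Countable I] [Countable J]
    (L : Matrix (I × J) κ ℝ) (l : I × J → ℝ) : MeasurableSet ((L *ᵥ ·) ⁻¹' rowExceedance l) :=
  measurableSet_preimage (by fun_prop : Continuous (L *ᵥ ·)).measurable
    (measurableSet_rowExceedance l)

lemma measure_rowExceedance_add_one_le [Finite I] [Finite J] {M N : Matrix (I × J) κ ℝ}
    (hMN : M * Nᵀ = 0) (hblock : ∀ i j k, (M * Mᵀ) (i, j) (i, k) = (N * Nᵀ) (i, j) (i, k))
    (hcov : ∀ p q, (N * Nᵀ) p q ≤ (M * Mᵀ) p q) (l : I × J → ℝ) :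
    stdGaussianPi κ ((M *ᵥ ·) ⁻¹' rowExceedance (l + 1)) ≤
      stdGaussianPi κ ((N *ᵥ ·) ⁻¹' rowExceedance l) := by
  classical
  cases nonempty_fintype I
  cases nonempty_fintype J
  let ψ : I × J → ℝ → ℝ := fun p t => Real.smoothTransition (t - l p)
  have hψ (p : I × J) : BoundedC1 (ψ p) := boundedC1_smoothTransition.comp_sub_const _
  have hψ' (p : I × J) : BoundedC1 (deriv (ψ p)) := by
    simpa only [ψ, funext (deriv_comp_sub_const _ _)] using
      boundedC1_deriv_smoothTransition.comp_sub_const (l p)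
  have hmono (p : I × J) : Monotone (ψ p) := fun s t hst =>
    Real.smoothTransition.monotone (by gcongr)
  have hIcc (p : I × J) (t : ℝ) : ψ p t ∈ Set.Icc (0 : ℝ) 1 :=
    ⟨Real.smoothTransition.nonneg _, Real.smoothTransition.le_one _⟩
  have hmeas := measurableSet_preimage_mulVec_rowExceedance (I := I) (J := J) (κ := κ)
  have hint (L : Matrix (I × J) κ ℝ) :
      Integrable (fun w => blockFun ψ (L *ᵥ w)) (stdGaussianPi κ) :=
    (boundedC1_blockFun hψ).integrable_comp_mulVec L
  have hindicator (L : Matrix (I × J) κ ℝ) (u : I × J → ℝ) :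
      Integrable (((L *ᵥ ·) ⁻¹' rowExceedance u).indicator 1) (stdGaussianPi κ) :=
    (integrable_const (1 : ℝ)).indicator (hmeas L u)
  refine (ENNReal.toReal_le_toReal (measure_ne_top _ _) (measure_ne_top _ _)).1 ?_
  calc (stdGaussianPi κ).real ((M *ᵥ ·) ⁻¹' rowExceedance (l + 1))
      ≤ ∫ w, (1 - blockFun ψ (M *ᵥ w)) ∂stdGaussianPi κ := by
        rw [← integral_indicator_one (hmeas M _)]
        refine integral_mono (hindicator M _) ((integrable_const 1).sub (hint M)) fun w =>
          indicator_rowExceedance_le_one_sub_blockFun hIcc (fun p t ht => ?_) (M *ᵥ w)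
        exact Real.smoothTransition.one_of_one_le (le_sub_iff_add_le'.2 ht.le)
    _ ≤ ∫ w, (1 - blockFun ψ (N *ᵥ w)) ∂stdGaussianPi κ := by
        rw [integral_sub (integrable_const 1) (hint M), integral_sub (integrable_const 1) (hint N)]
        exact sub_le_sub_left (integral_blockFun_mulVec_le hψ hψ' hmono hIcc hMN hblock hcov) _
    _ ≤ (stdGaussianPi κ).real ((N *ᵥ ·) ⁻¹' rowExceedance l) := by
        rw [← integral_indicator_one (hmeas N l)]
        refine integral_mono ((integrable_const 1).sub (hint N)) (hindicator N l) fun w =>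
          one_sub_blockFun_le_indicator_rowExceedance hIcc (fun p t ht => ?_) (N *ᵥ w)
        exact Real.smoothTransition.zero_of_nonpos (sub_nonpos.2 ht)

lemma smul_mem_rowExceedance_smul_iff {c : ℝ} (hc : 0 < c) (l z : I × J → ℝ) :
    c • z ∈ rowExceedance (c • l) ↔ z ∈ rowExceedance l := by
  simp only [rowExceedance, Set.mem_ofPred_eq, Pi.smul_apply, smul_eq_mul, mul_lt_mul_iff_right₀ hc]

lemma measure_rowExceedance_add_const_le [Finite I] [Finite J] {M N : Matrix (I × J) κ ℝ}
    (hMN : M * Nᵀ = 0) (hblock : ∀ i j k, (M * Mᵀ) (i, j) (i, k) = (N * Nᵀ) (i, j) (i, k))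
    (hcov : ∀ p q, (N * Nᵀ) p q ≤ (M * Mᵀ) p q) (l : I × J → ℝ) {ε : ℝ} (hε : 0 < ε) :
    stdGaussianPi κ ((M *ᵥ ·) ⁻¹' rowExceedance (l + Function.const _ ε)) ≤
      stdGaussianPi κ ((N *ᵥ ·) ⁻¹' rowExceedance l) := by
  have hscale (L L' : Matrix (I × J) κ ℝ) : (ε⁻¹ • L) * (ε⁻¹ • L')ᵀ = (ε⁻¹ * ε⁻¹) • (L * L'ᵀ) := by
    rw [Matrix.transpose_smul, Matrix.smul_mul, Matrix.mul_smul, smul_smul]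
  have hmargin : ε⁻¹ • (l + Function.const _ ε) = ε⁻¹ • l + 1 := by
    ext p
    simp [mul_add, hε.ne']
  have hpre (L : Matrix (I × J) κ ℝ) (u : I × J → ℝ) :
      (L *ᵥ ·) ⁻¹' rowExceedance u = ((ε⁻¹ • L) *ᵥ ·) ⁻¹' rowExceedance (ε⁻¹ • u) := by
    ext w
    simp only [Set.mem_preimage, Matrix.smul_mulVec,
      smul_mem_rowExceedance_smul_iff (inv_pos.2 hε)]
  rw [hpre M, hpre N, hmargin]
  refine measure_rowExceedance_add_one_le ?_ (fun i j k => ?_) (fun p q => ?_) _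
  · rw [hscale, hMN, smul_zero]
  · simp only [hscale, Matrix.smul_apply, hblock]
  · simpa only [hscale, Matrix.smul_apply] using smul_le_smul_of_nonneg_left (hcov p q)
      (mul_self_nonneg ε⁻¹)

lemma rowExceedance_eq_iUnion_add_const [Finite J] (l : I × J → ℝ) :
    rowExceedance l = ⋃ k : ℕ, rowExceedance (l + Function.const _ (1 / ((k : ℝ) + 1))) := by
  ext z
  simp only [rowExceedance, Set.mem_ofPred_eq, Set.mem_iUnion, Pi.add_apply, Function.const_apply]
  constructor
  · rintro ⟨i, hi⟩
    have hlim (j : J) : ∀ᶠ k : ℕ in atTop, l (i, j) + 1 / ((k : ℝ) + 1) < z (i, j) := by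
      filter_upwards [tendsto_one_div_add_atTop_nhds_zero_nat.eventually_lt_const
        (sub_pos.2 (hi j))] with k hk
      linarith
    exact (eventually_all.2 hlim).exists.imp fun k hk => ⟨i, hk⟩
  · rintro ⟨k, i, hi⟩
    exact ⟨i, fun j => (lt_add_of_pos_right _ Nat.one_div_pos_of_nat).trans (hi j)⟩

lemma monotone_rowExceedance_add_const (l : I × J → ℝ) :
    Monotone fun k : ℕ => rowExceedance (l + Function.const _ (1 / ((k : ℝ) + 1))) :=
  fun _ _ hkm _ ⟨i, hi⟩ =>
    ⟨i, fun j => (add_le_add_right (Nat.one_div_le_one_div hkm) _).trans_lt (hi j)⟩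

lemma measure_rowExceedance_le_of_mul_transpose_eq_zero [Finite I] [Finite J]
    {M N : Matrix (I × J) κ ℝ} (hMN : M * Nᵀ = 0)
    (hblock : ∀ i j k, (M * Mᵀ) (i, j) (i, k) = (N * Nᵀ) (i, j) (i, k))
    (hcov : ∀ p q, (N * Nᵀ) p q ≤ (M * Mᵀ) p q) (l : I × J → ℝ) :
    stdGaussianPi κ ((M *ᵥ ·) ⁻¹' rowExceedance l) ≤
      stdGaussianPi κ ((N *ᵥ ·) ⁻¹' rowExceedance l) := by
  rw [rowExceedance_eq_iUnion_add_const l, Set.preimage_iUnion,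
    Monotone.measure_iUnion fun _ _ h => Set.preimage_mono (monotone_rowExceedance_add_const l h),
    ← rowExceedance_eq_iUnion_add_const l]
  exact iSup_le fun k =>
    measure_rowExceedance_add_const_le hMN hblock hcov l Nat.one_div_pos_of_nat

/-- Gordon's comparison inequality. Placing the two Gaussian vectors on disjoint blocks of
coordinates makes them independent, which the interpolation needs. -/
theorem measure_rowExceedance_mulVec_le [Finite I] [Finite J] {M : Matrix (I × J) κ ℝ}
    {N : Matrix (I × J) κ' ℝ} (hblock : ∀ i j k, (M * Mᵀ) (i, j) (i, k) = (N * Nᵀ) (i, j) (i, k))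
    (hcov : ∀ p q, (N * Nᵀ) p q ≤ (M * Mᵀ) p q) (l : I × J → ℝ) :
    stdGaussianPi κ ((M *ᵥ ·) ⁻¹' rowExceedance l) ≤
      stdGaussianPi κ' ((N *ᵥ ·) ⁻¹' rowExceedance l) := by
  have hsplit := measurePreserving_sumPiEquivProdPi fun _ : κ ⊕ κ' => gaussianReal 0 1
  have hfst := (measurePreserving_fst.comp hsplit).measure_preimage
    (measurableSet_preimage_mulVec_rowExceedance M l).nullMeasurableSet
  have hsnd := (measurePreserving_snd.comp hsplit).measure_preimage
    (measurableSet_preimage_mulVec_rowExceedance N l).nullMeasurableSet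
  let M' : Matrix (I × J) (κ ⊕ κ') ℝ := Matrix.fromCols M 0
  let N' : Matrix (I × J) (κ ⊕ κ') ℝ := Matrix.fromCols 0 N
  have horth : M' * N'ᵀ = 0 := by
    rw [Matrix.transpose_fromCols, Matrix.fromCols_mul_fromRows, Matrix.transpose_zero,
      Matrix.mul_zero, Matrix.zero_mul, add_zero]
  have hM : M' * M'ᵀ = M * Mᵀ := by
    rw [Matrix.transpose_fromCols, Matrix.fromCols_mul_fromRows, Matrix.zero_mul, add_zero]
  have hN : N' * N'ᵀ = N * Nᵀ := by
    rw [Matrix.transpose_fromCols, Matrix.fromCols_mul_fromRows, Matrix.zero_mul, zero_add]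
  have hle := measure_rowExceedance_le_of_mul_transpose_eq_zero horth (by rwa [hM, hN])
    (by rwa [hM, hN]) l
  simp only [M', N', Matrix.fromCols_mulVec, Matrix.zero_mulVec, add_zero, zero_add] at hle
  rw [← hfst, ← hsnd]
  exact hle

end Gordon

section BilinearComparison

variable {I J R S : Type*} [Fintype R] [Fintype S]

lemma measurePreserving_curry_pi {X : Type*} [MeasurableSpace X] (μ : Measure X)
    [IsProbabilityMeasure μ] :
    MeasurePreserving (Function.curry : (R × S → X) → R → S → X) (Measure.pi fun _ => μ)
      (Measure.pi fun _ => Measure.pi fun _ => μ) := by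
  refine ⟨(MeasurableEquiv.curry R S X).measurable, ?_⟩
  simp only [← Measure.infinitePi_eq_pi]
  exact Measure.infinitePi_map_curry fun _ _ => μ

/-- The law of an array, indexed by the finite types `R` and `S`, of i.i.d. standard normal
variables, seen as the family of its rows. -/
noncomputable abbrev stdGaussianArray (R S : Type*) [Fintype R] [Fintype S] : Measure (R → S → ℝ) :=
  Measure.pi fun _ => stdGaussianPi S

variable (x : J → EuclideanSpace ℝ S) (y : I → EuclideanSpace ℝ R)

/-- The coefficients of the process `yᵀ C x + ‖x‖ ‖y‖ g₀` in the Gaussian vector `(C, g₀)`. -/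
noncomputable def bilinearCoeffs : Matrix (I × J) ((R × S) ⊕ Unit) ℝ :=
  Matrix.fromCols (Matrix.of fun p a => y p.1 a.1 * x p.2 a.2)
    (Matrix.of fun p _ => ‖x p.2‖ * ‖y p.1‖)

/-- The coefficients of the process `‖x‖ hᵀ y - ‖y‖ gᵀ x` in the Gaussian vector `(h, g)`. -/
noncomputable def linearCoeffs : Matrix (I × J) (R ⊕ S) ℝ :=
  Matrix.fromCols (Matrix.of fun p r => ‖x p.2‖ * y p.1 r)
    (Matrix.of fun p s => -(‖y p.1‖ * x p.2 s))

lemma bilinearCoeffs_mulVec (w : (R × S) ⊕ Unit → ℝ) (p : I × J) :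
    (bilinearCoeffs x y *ᵥ w) p =
      (y p.1).ofLp ⬝ᵥ (Matrix.of (Function.curry (w ∘ Sum.inl)) *ᵥ (x p.2).ofLp) +
        ‖x p.2‖ * ‖y p.1‖ * w (Sum.inr ()) := by
  rw [bilinearCoeffs, Matrix.fromCols_mulVec, Pi.add_apply]
  simp only [Matrix.mulVec, dotProduct, Matrix.of_apply, Fintype.sum_prod_type, Finset.univ_unique,
    Finset.sum_singleton, Function.comp_apply, Function.curry_apply, Finset.mul_sum]
  congr! 3
  ring

lemma linearCoeffs_mulVec (w : R ⊕ S → ℝ) (p : I × J) :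
    (linearCoeffs x y *ᵥ w) p = ‖x p.2‖ * ((w ∘ Sum.inl) ⬝ᵥ (y p.1).ofLp) -
      ‖y p.1‖ * ((w ∘ Sum.inr) ⬝ᵥ (x p.2).ofLp) := by
  rw [linearCoeffs, Matrix.fromCols_mulVec, Pi.add_apply, sub_eq_add_neg]
  simp only [Matrix.mulVec, dotProduct, Matrix.of_apply, Function.comp_apply, Finset.mul_sum,
    ← Finset.sum_neg_distrib]
  congr! 2 <;> ring

lemma bilinearCoeffs_mul_transpose_apply (p q : I × J) :
    (bilinearCoeffs x y * (bilinearCoeffs x y)ᵀ) p q =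
      inner ℝ (y p.1) (y q.1) * inner ℝ (x p.2) (x q.2) +
        ‖x p.2‖ * ‖y p.1‖ * (‖x q.2‖ * ‖y q.1‖) := by
  rw [bilinearCoeffs, Matrix.transpose_fromCols, Matrix.fromCols_mul_fromRows, Matrix.add_apply]
  simp only [Matrix.mul_apply, Matrix.transpose_apply, Matrix.of_apply, Fintype.sum_prod_type,
    Finset.univ_unique, Finset.sum_singleton, PiLp.inner_apply, Finset.sum_mul_sum,
    RCLike.inner_apply, conj_trivial]
  congr! 3
  ring

lemma linearCoeffs_mul_transpose_apply (p q : I × J) :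
    (linearCoeffs x y * (linearCoeffs x y)ᵀ) p q =
      ‖x p.2‖ * ‖x q.2‖ * inner ℝ (y p.1) (y q.1) +
        ‖y p.1‖ * ‖y q.1‖ * inner ℝ (x p.2) (x q.2) := by
  rw [linearCoeffs, Matrix.transpose_fromCols, Matrix.fromCols_mul_fromRows, Matrix.add_apply]
  simp only [Matrix.mul_apply, Matrix.transpose_apply, Matrix.of_apply, PiLp.inner_apply,
    Finset.mul_sum, RCLike.inner_apply, conj_trivial]
  congr! 2 <;> ring

lemma bilinearCoeffs_covariance_sub_linearCoeffs_covariance (p q : I × J) :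
    (bilinearCoeffs x y * (bilinearCoeffs x y)ᵀ) p q -
        (linearCoeffs x y * (linearCoeffs x y)ᵀ) p q =
      (‖x p.2‖ * ‖x q.2‖ - inner ℝ (x p.2) (x q.2)) *
        (‖y p.1‖ * ‖y q.1‖ - inner ℝ (y p.1) (y q.1)) := by
  rw [bilinearCoeffs_mul_transpose_apply, linearCoeffs_mul_transpose_apply]
  ring

theorem measure_bilinear_add_le_measure_linear [Finite I] [Finite J] (b : J → ℝ) :
    ((stdGaussianArray R S).prod (gaussianReal 0 1)) {z | ∃ i, ∀ j,
        b j < (y i).ofLp ⬝ᵥ (Matrix.of z.1 *ᵥ (x j).ofLp) + ‖x j‖ * ‖y i‖ * z.2} ≤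
      ((stdGaussianPi R).prod (stdGaussianPi S)) {z | ∃ i, ∀ j,
        b j < ‖x j‖ * (z.1 ⬝ᵥ (y i).ofLp) - ‖y i‖ * (z.2 ⬝ᵥ (x j).ofLp)} := by
  have hgordon := measure_rowExceedance_mulVec_le (M := bilinearCoeffs x y) (N := linearCoeffs x y)
    (fun i j k => ?_) (fun p q => ?_) (fun p => b p.2)
  · have hbilinear : MeasurePreserving
        (fun w : (R × S) ⊕ Unit → ℝ => (Function.curry (w ∘ Sum.inl), w (Sum.inr ())))
        (stdGaussianPi _) ((stdGaussianArray R S).prod (gaussianReal 0 1)) :=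
      ((measurePreserving_curry_pi (gaussianReal 0 1)).prod (measurePreserving_eval _ ())).comp
        (measurePreserving_sumPiEquivProdPi fun _ => gaussianReal 0 1)
    have hlinear : MeasurePreserving (fun w : R ⊕ S → ℝ => (w ∘ Sum.inl, w ∘ Sum.inr))
        (stdGaussianPi _) ((stdGaussianPi R).prod (stdGaussianPi S)) :=
      measurePreserving_sumPiEquivProdPi fun _ => gaussianReal 0 1
    have hmeas : MeasurableSet {z : (R → S → ℝ) × ℝ | ∃ i, ∀ j,
        b j < (y i).ofLp ⬝ᵥ (Matrix.of z.1 *ᵥ (x j).ofLp) + ‖x j‖ * ‖y i‖ * z.2} := by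
      simp only [Set.ofPred_exists, Set.ofPred_forall]
      exact (isOpen_iUnion fun i => isOpen_iInter_of_finite fun j =>
        isOpen_lt (by fun_prop) (by fun_prop)).measurableSet
    have hmeas' : MeasurableSet {z : (R → ℝ) × (S → ℝ) | ∃ i, ∀ j,
        b j < ‖x j‖ * (z.1 ⬝ᵥ (y i).ofLp) - ‖y i‖ * (z.2 ⬝ᵥ (x j).ofLp)} := by
      simp only [Set.ofPred_exists, Set.ofPred_forall]
      exact (isOpen_iUnion fun i => isOpen_iInter_of_finite fun j =>
        isOpen_lt (by fun_prop) (by fun_prop)).measurableSet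
    rw [← hbilinear.measure_preimage hmeas.nullMeasurableSet,
      ← hlinear.measure_preimage hmeas'.nullMeasurableSet]
    simpa only [rowExceedance, Set.preimage_ofPred_eq, bilinearCoeffs_mulVec,
      linearCoeffs_mulVec] using hgordon
  · rw [← sub_eq_zero, bilinearCoeffs_covariance_sub_linearCoeffs_covariance,
      real_inner_self_eq_norm_mul_norm (y i), sub_self, mul_zero]
  · rw [← sub_nonneg, bilinearCoeffs_covariance_sub_linearCoeffs_covariance]
    exact mul_nonneg (sub_nonneg.2 (real_inner_le_norm _ _)) (sub_nonneg.2 (real_inner_le_norm _ _))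

theorem measure_bilinear_mul_le_measure_linear [Finite I] [Finite J] (b : J → ℝ) :
    stdGaussianArray R S {C | ∃ i, ∀ j, b j < (y i).ofLp ⬝ᵥ (Matrix.of C *ᵥ (x j).ofLp)} *
        gaussianReal 0 1 (Set.Ioi 0) ≤
      ((stdGaussianPi R).prod (stdGaussianPi S)) {z | ∃ i, ∀ j,
        b j < ‖x j‖ * (z.1 ⬝ᵥ (y i).ofLp) - ‖y i‖ * (z.2 ⬝ᵥ (x j).ofLp)} := by
  rw [← Measure.prod_prod]
  refine (measure_mono ?_).trans (measure_bilinear_add_le_measure_linear x y b)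
  rintro ⟨C, g₀⟩ ⟨⟨i, hi⟩, hg₀ : 0 < g₀⟩
  exact ⟨i, fun j => (hi j).trans_le (le_add_of_nonneg_right (by positivity))⟩

end BilinearComparison

section GaussianProjection

lemma memLp_sq_gaussianReal : MemLp (fun t : ℝ => t ^ 2) 2 (gaussianReal 0 1) := by
  refine (memLp_two_iff_integrable_sq (by fun_prop)).2 ?_
  have hfour := (memLp_id_gaussianReal' (μ := 0) (v := 1) 4 (by simp)).integrable_norm_pow
    (p := 4) (by norm_num)
  refine hfour.congr (ae_of_all _ fun t => ?_)
  exact (Even.pow_abs (by decide) t).trans (pow_mul t 2 2)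

lemma memLp_sq_posPart_gaussianReal : MemLp (fun t : ℝ => (max t 0) ^ 2) 2 (gaussianReal 0 1) := by
  refine memLp_sq_gaussianReal.mono (by fun_prop) (ae_of_all _ fun t => ?_)
  rw [norm_pow, norm_pow]
  gcongr
  exact abs_max_le_max_abs_abs.trans (by simp)

lemma integral_sq_gaussianReal : ∫ t, t ^ 2 ∂gaussianReal 0 1 = 1 := by
  have hvar := variance_fun_id_gaussianReal (μ := 0) (v := 1)
  rw [variance_eq_integral (by fun_prop), integral_id_gaussianReal] at hvar
  simpa using hvar

lemma integral_sq_posPart_gaussianReal : ∫ t, (max t 0) ^ 2 ∂gaussianReal 0 1 = 1 / 2 := by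
  have hneg : MeasurePreserving (fun t : ℝ => -t) (gaussianReal 0 1) (gaussianReal 0 1) :=
    ⟨measurable_neg, by rw [gaussianReal_map_neg, neg_zero]⟩
  have hsymm : ∫ t, (max (-t) 0) ^ 2 ∂gaussianReal 0 1 = ∫ t, (max t 0) ^ 2 ∂gaussianReal 0 1 :=
    hneg.integral_comp (MeasurableEquiv.neg ℝ).measurableEmbedding fun t => (max t 0) ^ 2
  have hint : Integrable (fun t : ℝ => (max t 0) ^ 2) (gaussianReal 0 1) :=
    memLp_sq_posPart_gaussianReal.integrable (by norm_num)
  have hint' : Integrable (fun t : ℝ => (max (-t) 0) ^ 2) (gaussianReal 0 1) :=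
    hneg.integrable_comp_of_integrable hint
  have hsum : ∫ t, ((max t 0) ^ 2 + (max (-t) 0) ^ 2) ∂gaussianReal 0 1 = 1 := by
    rw [← integral_sq_gaussianReal]
    congr! 2 with t
    rcases le_total t 0 with h | h <;> simp [h]
  rw [integral_add hint hint', hsymm] at hsum
  linarith

variable {ι₁ ι₂ S : Type*}

/-- The contribution of a component `t`, indexed by `r`, to `projSq`. -/
def projSqSummand : ι₁ ⊕ ι₂ → ℝ → ℝ
  | Sum.inl _ => fun t => t ^ 2
  | Sum.inr _ => fun t => (max t 0) ^ 2

lemma memLp_projSqSummand (r : ι₁ ⊕ ι₂) : MemLp (projSqSummand r) 2 (gaussianReal 0 1) := by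
  rcases r with _ | _
  exacts [memLp_sq_gaussianReal, memLp_sq_posPart_gaussianReal]

variable [Fintype ι₁] [Fintype ι₂] [Fintype S]

/-- The squared norm of the projection of `h` onto the cone of vectors whose components indexed by
`ι₂` are nonnegative. -/
def projSq (h : ι₁ ⊕ ι₂ → ℝ) : ℝ :=
  ∑ r, projSqSummand r (h r)

lemma dotProduct_le_sqrt_projSq_mul_norm (h : ι₁ ⊕ ι₂ → ℝ) {y : EuclideanSpace ℝ (ι₁ ⊕ ι₂)}
    (hy : ∀ i, 0 ≤ y (Sum.inr i)) : h ⬝ᵥ y.ofLp ≤ √(projSq h) * ‖y‖ := by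
  let p : EuclideanSpace ℝ (ι₁ ⊕ ι₂) :=
    WithLp.toLp 2 (Sum.elim (h ∘ Sum.inl) fun i => max (h (Sum.inr i)) 0)
  have hp : ‖p‖ = √(projSq h) := by
    simp [EuclideanSpace.norm_eq, projSq, projSqSummand, p]
  have hdot : h ⬝ᵥ y.ofLp ≤ inner ℝ y p := by
    rw [dotProduct, PiLp.inner_apply]
    refine Finset.sum_le_sum fun r _ => ?_
    rcases r with r | r
    · exact le_rfl
    · exact mul_le_mul_of_nonneg_right (le_max_left _ _) (hy r)
  rw [← hp, mul_comm]
  exact hdot.trans (real_inner_le_norm y p)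

lemma memLp_projSqSummand_eval (r : ι₁ ⊕ ι₂) :
    MemLp (fun h : ι₁ ⊕ ι₂ → ℝ => projSqSummand r (h r)) 2 (stdGaussianPi (ι₁ ⊕ ι₂)) :=
  (memLp_projSqSummand r).comp_measurePreserving
    (measurePreserving_eval (fun _ => gaussianReal 0 1) r)

lemma memLp_projSq : MemLp projSq 2 (stdGaussianPi (ι₁ ⊕ ι₂)) :=
  memLp_finsetSum _ fun r _ => memLp_projSqSummand_eval r

lemma integral_projSq :
    ∫ h, projSq h ∂stdGaussianPi (ι₁ ⊕ ι₂) = Fintype.card ι₁ + (Fintype.card ι₂ : ℝ) / 2 := by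
  simp only [projSq]
  rw [integral_finsetSum _ fun r _ => (memLp_projSqSummand_eval r).integrable (by norm_num)]
  have heval (r : ι₁ ⊕ ι₂) : ∫ h, projSqSummand r (h r) ∂stdGaussianPi (ι₁ ⊕ ι₂) =
      ∫ t, projSqSummand r t ∂gaussianReal 0 1 :=
    integral_comp_eval (memLp_projSqSummand r).aestronglyMeasurable
  simp only [heval]
  simp [projSqSummand, integral_sq_gaussianReal, integral_sq_posPart_gaussianReal, div_eq_mul_inv]

lemma variance_projSq :
    Var[projSq; stdGaussianPi (ι₁ ⊕ ι₂)] =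
      Fintype.card ι₁ * Var[fun t => t ^ 2; gaussianReal 0 1] +
        Fintype.card ι₂ * Var[fun t => (max t 0) ^ 2; gaussianReal 0 1] := by
  have hsum : projSq = ∑ r : ι₁ ⊕ ι₂, fun h : ι₁ ⊕ ι₂ → ℝ => projSqSummand r (h r) := by
    ext h
    rw [projSq, Finset.sum_apply]
  rw [hsum, variance_sum_pi memLp_projSqSummand]
  simp [projSqSummand]

lemma measure_sq_le_projSq_le {δ : ℝ} (hδ : 0 < δ) :
    stdGaussianPi (ι₁ ⊕ ι₂)
        {h | (√(Fintype.card ι₁ + (Fintype.card ι₂ : ℝ) / 2) + δ) ^ 2 ≤ projSq h} ≤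
      ENNReal.ofReal ((Var[fun t => t ^ 2; gaussianReal 0 1] +
        2 * Var[fun t => (max t 0) ^ 2; gaussianReal 0 1]) / (4 * δ ^ 2)) := by
  set D : ℝ := Fintype.card ι₁ + (Fintype.card ι₂ : ℝ) / 2 with hD
  set v₁ := Var[fun t => t ^ 2; gaussianReal 0 1]
  set v₂ := Var[fun t => (max t 0) ^ 2; gaussianReal 0 1]
  have hv₁ : 0 ≤ v₁ := variance_nonneg _ _
  have hv₂ : 0 ≤ v₂ := variance_nonneg _ _
  have hD₀ : 0 ≤ D := by positivity
  have hdev : 4 * δ ^ 2 * D ≤ (2 * δ * √D + δ ^ 2) ^ 2 := by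
    calc 4 * δ ^ 2 * D = (2 * δ * √D) ^ 2 := by rw [mul_pow, mul_pow, Real.sq_sqrt hD₀]; ring
      _ ≤ (2 * δ * √D + δ ^ 2) ^ 2 := by gcongr; exact le_add_of_nonneg_right (by positivity)
  have hvar : Var[projSq; stdGaussianPi (ι₁ ⊕ ι₂)] ≤ (v₁ + 2 * v₂) * D := by
    rw [variance_projSq, hD]
    have h₁ : 0 ≤ (Fintype.card ι₁ : ℝ) * v₂ := by positivity
    have h₂ : 0 ≤ (Fintype.card ι₂ : ℝ) * v₁ := by positivity
    linarith
  refine (measure_mono fun h hh => ?_).trans ((meas_ge_le_variance_div_sq memLp_projSq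
    (c := 2 * δ * √D + δ ^ 2) (by positivity)).trans (ENNReal.ofReal_le_ofReal ?_))
  · rw [Set.mem_ofPred_eq, integral_projSq, ← hD]
    refine le_trans ?_ (le_abs_self _)
    linarith [Set.mem_ofPred_eq ▸ hh, add_sq √D δ, Real.sq_sqrt hD₀]
  · rw [div_le_div_iff₀ (by positivity) (by positivity)]
    calc Var[projSq; stdGaussianPi (ι₁ ⊕ ι₂)] * (4 * δ ^ 2)
        ≤ (v₁ + 2 * v₂) * D * (4 * δ ^ 2) := by gcongr
      _ = (v₁ + 2 * v₂) * (4 * δ ^ 2 * D) := by ring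
      _ ≤ (v₁ + 2 * v₂) * (2 * δ * √D + δ ^ 2) ^ 2 := by gcongr

/-- The directions `x` with `s ‖x‖ < gᵀ x`, together with the origin. Unlike in the constraint
`s ‖x‖ ≤ gᵀ x` of the auxiliary program, the inequality is strict, so that membership of a fixed `x`
is an open condition on `g`. -/
def strictCone (s : ℝ) (g : S → ℝ) : Set (EuclideanSpace ℝ S) :=
  {x | x = 0 ∨ s * ‖x‖ < g ⬝ᵥ x.ofLp}

lemma isOpen_setOf_mem_strictCone (s : ℝ) (x : EuclideanSpace ℝ S) :
    IsOpen {g | x ∈ strictCone s g} :=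
  isOpen_const.union (isOpen_lt continuous_const
    (continuous_id.dotProduct (continuous_const (y := x.ofLp))))

lemma isClosed_setOf_forall_mem_strictCone (s : ℝ) (p : EuclideanSpace ℝ S → Prop) :
    IsClosed {g : S → ℝ | ∀ x ∈ strictCone s g, p x} := by
  simp only [Set.ofPred_forall]
  exact isClosed_iInter fun x => isClosed_imp (isOpen_setOf_mem_strictCone s x) isClosed_const

lemma le_dotProduct_of_mem_strictCone {s : ℝ} {g : S → ℝ} {x : EuclideanSpace ℝ S}
    (hx : x ∈ strictCone s g) : s * ‖x‖ ≤ g ⬝ᵥ x.ofLp := by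
  rcases hx with rfl | hx
  · simp
  · exact hx.le

lemma mem_strictCone_of_le_dotProduct {s s' : ℝ} (hs : s < s') {g : S → ℝ}
    {x : EuclideanSpace ℝ S} (hx : s' * ‖x‖ ≤ g ⬝ᵥ x.ofLp) : x ∈ strictCone s g := by
  rcases eq_or_ne x 0 with rfl | hx₀
  · exact Or.inl rfl
  · exact Or.inr ((mul_lt_mul_of_pos_right hs (norm_pos_iff.2 hx₀)).trans_le hx)

theorem measure_linear_le_measure_strictCone_add {I J : Type*} (x : J → EuclideanSpace ℝ S)
    {y : I → EuclideanSpace ℝ (ι₁ ⊕ ι₂)} (hy : ∀ i k, 0 ≤ y i (Sum.inr k)) (b : J → ℝ) {s : ℝ}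
    (hs : 0 ≤ s) :
    ((stdGaussianPi (ι₁ ⊕ ι₂)).prod (stdGaussianPi S)) {z | ∃ i, ∀ j,
        b j < ‖x j‖ * (z.1 ⬝ᵥ (y i).ofLp) - ‖y i‖ * (z.2 ⬝ᵥ (x j).ofLp)} ≤
      stdGaussianPi S {g | ∀ j, x j ∈ strictCone s g → b j < 0} +
        stdGaussianPi (ι₁ ⊕ ι₂) {h | s ^ 2 ≤ projSq h} := by
  set G : Set (S → ℝ) := {g | ∀ j, x j ∈ strictCone s g → b j < 0}
  set H : Set (ι₁ ⊕ ι₂ → ℝ) := {h | s ^ 2 ≤ projSq h}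
  calc _ ≤ ((stdGaussianPi (ι₁ ⊕ ι₂)).prod (stdGaussianPi S)) (Set.univ ×ˢ G ∪ H ×ˢ Set.univ) := by
        refine measure_mono ?_
        rintro ⟨h, g⟩ ⟨i, hi⟩
        by_cases hh : s ^ 2 ≤ projSq h
        · exact Or.inr ⟨hh, trivial⟩
        refine Or.inl ⟨trivial, fun j hj => (hi j).trans_le (sub_nonpos.2 ?_)⟩
        calc ‖x j‖ * (h ⬝ᵥ (y i).ofLp) ≤ ‖x j‖ * (√(projSq h) * ‖y i‖) := by
              gcongr
              exact dotProduct_le_sqrt_projSq_mul_norm h (hy i)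
          _ ≤ ‖x j‖ * (s * ‖y i‖) := by
              gcongr
              exact Real.sqrt_le_iff.2 ⟨hs, (not_le.1 hh).le⟩
          _ = ‖y i‖ * (s * ‖x j‖) := by ring
          _ ≤ ‖y i‖ * (g ⬝ᵥ (x j).ofLp) := by
              gcongr
              exact le_dotProduct_of_mem_strictCone hj
    _ ≤ _ := (measure_union_le _ _).trans_eq (by
        rw [Measure.prod_prod, Measure.prod_prod, measure_univ, measure_univ, one_mul, mul_one])

end GaussianProjection

section LindelofUnions

variable {X ι : Type*} [TopologicalSpace X] [HereditarilyLindelofSpace X] [MeasurableSpace X]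

lemma measure_iUnion_eq_iSup_finset_of_isOpen (μ : Measure X) {U : ι → Set X}
    (hU : ∀ i, IsOpen (U i)) : μ (⋃ i, U i) = ⨆ t : Finset ι, μ (⋃ i ∈ t, U i) := by
  refine le_antisymm ?_ (iSup_le fun t => measure_mono (Set.iUnion₂_subset_iUnion _ _))
  obtain ⟨T, hT, hTU⟩ := eq_open_union_countable U hU
  have := hT.to_subtype
  have hfinite : ⋃ i, U i = ⋃ t : Finset T, ⋃ i ∈ t, U i := by
    rw [← hTU, Set.biUnion_eq_iUnion]
    exact Set.iUnion_eq_iUnion_finset _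
  rw [hfinite, Directed.measure_iUnion]
  · refine iSup_le fun t => le_iSup_of_le (t.map (Function.Embedding.subtype _)) (measure_mono ?_)
    simp
  · exact Monotone.directed_le fun t t' ht => Set.biUnion_subset_biUnion_left ht

lemma measure_iInter_eq_iInf_finset_of_isClosed [OpensMeasurableSpace X] (μ : Measure X)
    [IsFiniteMeasure μ] {Z : ι → Set X} (hZ : ∀ i, IsClosed (Z i)) :
    μ (⋂ i, Z i) = ⨅ t : Finset ι, μ (⋂ i ∈ t, Z i) := by
  have hsub (V : Set X) (hV : IsOpen V) : μ Vᶜ = μ Set.univ - μ V :=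
    measure_compl hV.measurableSet (measure_ne_top μ V)
  have hU (i) : IsOpen (Z i)ᶜ := (hZ i).isOpen_compl
  calc μ (⋂ i, Z i) = μ (⋃ i, (Z i)ᶜ)ᶜ := by simp only [Set.compl_iUnion, compl_compl]
    _ = μ Set.univ - ⨆ t : Finset ι, μ (⋃ i ∈ t, (Z i)ᶜ) := by
        rw [hsub _ (isOpen_iUnion hU), measure_iUnion_eq_iSup_finset_of_isOpen μ hU]
    _ = ⨅ t : Finset ι, μ (⋃ i ∈ t, (Z i)ᶜ)ᶜ := by
        rw [ENNReal.sub_iSup (measure_ne_top μ _)]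
        exact iInf_congr fun t => (hsub _ (isOpen_biUnion fun i _ => hU i)).symm
    _ = ⨅ t : Finset ι, μ (⋂ i ∈ t, Z i) := by simp only [Set.compl_iUnion, compl_compl]

end LindelofUnions

section GordonDuality

variable {ι₁ ι₂ S I J : Type*} [Fintype ι₁] [Fintype ι₂] [Fintype S]

lemma measure_exists_bilinear_mul_le_of_finite [Finite J] (x : J → EuclideanSpace ℝ S)
    {y : I → EuclideanSpace ℝ (ι₁ ⊕ ι₂)} (hy : ∀ i k, 0 ≤ y i (Sum.inr k)) (b : J → ℝ) {s : ℝ}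
    (hs : 0 ≤ s) :
    stdGaussianArray (ι₁ ⊕ ι₂) S {C | ∃ i, ∀ j,
        b j < (y i).ofLp ⬝ᵥ (Matrix.of C *ᵥ (x j).ofLp)} * gaussianReal 0 1 (Set.Ioi 0) ≤
      stdGaussianPi S {g | ∀ j, x j ∈ strictCone s g → b j < 0} +
        stdGaussianPi (ι₁ ⊕ ι₂) {h | s ^ 2 ≤ projSq h} := by
  have hopen (i) : IsOpen {C : ι₁ ⊕ ι₂ → S → ℝ | ∀ j,
      b j < (y i).ofLp ⬝ᵥ (Matrix.of C *ᵥ (x j).ofLp)} := by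
    simp only [Set.ofPred_forall]
    exact isOpen_iInter_of_finite fun j => isOpen_lt (by fun_prop) (by fun_prop)
  rw [Set.ofPred_exists, measure_iUnion_eq_iSup_finset_of_isOpen _ hopen, ENNReal.iSup_mul]
  refine iSup_le fun t => le_trans ?_
    ((measure_bilinear_mul_le_measure_linear x (fun i : t => y i) b).trans
      (measure_linear_le_measure_strictCone_add x (fun i : t => hy i) b hs))
  gcongr
  intro C hC
  simpa using hC

theorem measure_exists_bilinear_mul_le (x : J → EuclideanSpace ℝ S)
    {y : I → EuclideanSpace ℝ (ι₁ ⊕ ι₂)} (hy : ∀ i k, 0 ≤ y i (Sum.inr k)) (b : J → ℝ) {s : ℝ}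
    (hs : 0 ≤ s) :
    stdGaussianArray (ι₁ ⊕ ι₂) S {C | ∃ i, ∀ j,
        b j < (y i).ofLp ⬝ᵥ (Matrix.of C *ᵥ (x j).ofLp)} * gaussianReal 0 1 (Set.Ioi 0) ≤
      stdGaussianPi S {g | ∀ j, x j ∈ strictCone s g → b j < 0} +
        stdGaussianPi (ι₁ ⊕ ι₂) {h | s ^ 2 ≤ projSq h} := by
  have hclosed (j) : IsClosed {g : S → ℝ | x j ∈ strictCone s g → b j < 0} :=
    isClosed_imp (isOpen_setOf_mem_strictCone s (x j)) isClosed_const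
  rw [Set.ofPred_forall, measure_iInter_eq_iInf_finset_of_isClosed _ hclosed, ENNReal.iInf_add]
  refine le_iInf fun t => le_trans ?_
    ((measure_exists_bilinear_mul_le_of_finite (fun j : t => x j) hy (fun j => b j) hs).trans
      ?_)
  · gcongr with C i
    exact fun hi j => hi j
  · gcongr
    intro g hg
    simpa using hg

end GordonDuality

section FixedDimension

variable {m₁ m₂ n : ℕ}

instance isProbabilityMeasure_gaussianVector : IsProbabilityMeasure (gaussianVector n) := by
  unfold gaussianVector; infer_instance

instance isProbabilityMeasure_gaussianMatrix : IsProbabilityMeasure (gaussianMatrix m₁ n) := by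
  unfold gaussianMatrix; infer_instance

instance isProbabilityMeasure_gaussianPair : IsProbabilityMeasure (gaussianPair m₁ m₂ n) := by
  unfold gaussianPair; infer_instance

lemma lagrangian_eq_add_dotProduct_mulVec (f : EuclideanSpace ℝ (Fin n) → ℝ)
    (C : Fin m₁ ⊕ Fin m₂ → Fin n → ℝ) (x : EuclideanSpace ℝ (Fin n)) (ν : Fin m₁ → ℝ)
    (l : Fin m₂ → ℝ) :
    lagrangian f (Matrix.of (C ∘ Sum.inl)) (Matrix.of (C ∘ Sum.inr)) x ν l =
      f x + Sum.elim ν l ⬝ᵥ (Matrix.of C *ᵥ x.ofLp) := by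
  simp only [lagrangian, dotProduct, Matrix.mulVec, Matrix.of_apply, Fintype.sum_sum_type,
    Sum.elim_inl, Sum.elim_inr, Function.comp_apply, add_assoc]

theorem measure_exists_multiplier_mul_le (f : EuclideanSpace ℝ (Fin n) → ℝ) (a : ℝ) {s : ℝ}
    (hs : 0 ≤ s) :
    gaussianPair m₁ m₂ n {C | ∃ ν l, 0 ≤ l ∧ ∀ x,
        a < lagrangian f (Matrix.of C.1) (Matrix.of C.2) x ν l} * gaussianReal 0 1 (Set.Ioi 0) ≤
      gaussianVector n {g | ∀ x ∈ strictCone s g, a < f x} +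
        stdGaussianPi (Fin m₁ ⊕ Fin m₂) {h | s ^ 2 ≤ projSq h} := by
  have hpair : MeasurePreserving
      (MeasurableEquiv.sumPiEquivProdPi fun _ : Fin m₁ ⊕ Fin m₂ => Fin n → ℝ)
      (stdGaussianArray (Fin m₁ ⊕ Fin m₂) (Fin n)) (gaussianPair m₁ m₂ n) :=
    measurePreserving_sumPiEquivProdPi fun _ => stdGaussianPi (Fin n)
  rw [← hpair.measure_preimage_equiv]
  have hcomparison := measure_exists_bilinear_mul_le (ι₁ := Fin m₁) (ι₂ := Fin m₂)
    (fun x : EuclideanSpace ℝ (Fin n) => x)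
    (y := fun y : {y : EuclideanSpace ℝ (Fin m₁ ⊕ Fin m₂) // ∀ k, 0 ≤ y (Sum.inr k)} => y.1)
    Subtype.prop (fun x => a - f x) hs
  simp only [sub_neg] at hcomparison
  refine le_trans ?_ hcomparison
  gcongr
  rintro C ⟨ν, l, hl, h⟩
  refine ⟨⟨WithLp.toLp 2 (Sum.elim ν l), hl⟩, fun x => sub_lt_iff_lt_add'.2 ?_⟩
  rw [← lagrangian_eq_add_dotProduct_mulVec]
  exact h x

lemma StrongDuality.exists_multiplier {f : EuclideanSpace ℝ (Fin n) → ℝ}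
    {A : Matrix (Fin m₁) (Fin n) ℝ} {B : Matrix (Fin m₂) (Fin n) ℝ} (hSD : StrongDuality f A B)
    {a : ℝ} (ha : (a : EReal) < optValue f A B) :
    ∃ ν l, 0 ≤ l ∧ ∀ x, a < lagrangian f A B x ν l := by
  rw [hSD.2] at ha
  simp only [lt_iSup_iff] at ha
  obtain ⟨ν, l, hl, ha⟩ := ha
  exact ⟨ν, l, hl, fun x => EReal.coe_lt_coe_iff.1 (ha.trans_le (iInf_le _ x))⟩

lemma exists_mem_strictCone_of_auxValue_lt {f : EuclideanSpace ℝ (Fin n) → ℝ} {ε₁ ε₅ s t δ : ℝ}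
    (hlt : s < (1 + ε₁) * √((m₁ : ℝ) + (m₂ : ℝ) / 2) + ε₅ * √(n : ℝ)) {g : Fin n → ℝ}
    (h : auxValue m₁ m₂ ε₁ ε₅ f t g < (δ : EReal)) : ∃ x ∈ strictCone s g, f x < t + δ := by
  simp only [auxValue, iInf_lt_iff, EReal.coe_lt_coe_iff] at h
  obtain ⟨x, hx, hfx⟩ := h
  exact ⟨x, mem_strictCone_of_le_dotProduct hlt (by linarith), by linarith⟩

theorem measure_lt_optValue_mul_le_measure_strictCone (f : EuclideanSpace ℝ (Fin n) → ℝ) (a : ℝ)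
    {s : ℝ} (hs : 0 ≤ s) :
    gaussianPair m₁ m₂ n {C | StrongDuality f (Matrix.of C.1) (Matrix.of C.2) ∧
        (a : EReal) < optValue f (Matrix.of C.1) (Matrix.of C.2)} * gaussianReal 0 1 (Set.Ioi 0) ≤
      gaussianVector n {g | ∀ x ∈ strictCone s g, a < f x} +
        stdGaussianPi (Fin m₁ ⊕ Fin m₂) {h | s ^ 2 ≤ projSq h} := by
  refine le_trans ?_ (measure_exists_multiplier_mul_le f a hs)
  gcongr with C
  exact fun ⟨hSD, ha⟩ => hSD.exists_multiplier ha

theorem measure_lt_optValue_mul_le (f : EuclideanSpace ℝ (Fin n) → ℝ) (t : ℝ) {ε₁ ε₅ s : ℝ}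
    (hs : 0 ≤ s) (hlt : s < (1 + ε₁) * √((m₁ : ℝ) + (m₂ : ℝ) / 2) + ε₅ * √(n : ℝ)) :
    gaussianPair m₁ m₂ n {C | StrongDuality f (Matrix.of C.1) (Matrix.of C.2) ∧
        (t : EReal) < optValue f (Matrix.of C.1) (Matrix.of C.2)} * gaussianReal 0 1 (Set.Ioi 0) ≤
      gaussianVector n {g | auxValue m₁ m₂ ε₁ ε₅ f t g ≤ 0}ᶜ +
        stdGaussianPi (Fin m₁ ⊕ Fin m₂) {h | s ^ 2 ≤ projSq h} := by
  obtain ⟨u, hu, htu, hlim⟩ := exists_seq_strictAnti_tendsto t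
  let V : ℕ → Set ((Fin m₁ → Fin n → ℝ) × (Fin m₂ → Fin n → ℝ)) := fun k =>
    {C | StrongDuality f (Matrix.of C.1) (Matrix.of C.2) ∧
      (u k : EReal) < optValue f (Matrix.of C.1) (Matrix.of C.2)}
  have hV : Monotone V := fun k k' hk C hC =>
    ⟨hC.1, (EReal.coe_le_coe_iff.2 (hu.antitone hk)).trans_lt hC.2⟩
  have hunion : {C : (Fin m₁ → Fin n → ℝ) × (Fin m₂ → Fin n → ℝ) |
      StrongDuality f (Matrix.of C.1) (Matrix.of C.2) ∧
        (t : EReal) < optValue f (Matrix.of C.1) (Matrix.of C.2)} ⊆ ⋃ k, V k := by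
    rintro C ⟨hSD, ht⟩
    obtain ⟨k, hk⟩ := (((continuous_coe_real_ereal.tendsto t).comp hlim).eventually_lt_const
      ht).exists
    exact Set.mem_iUnion.2 ⟨k, hSD, hk⟩
  refine (mul_le_mul_left (measure_mono hunion) _).trans ?_
  rw [hV.measure_iUnion, ENNReal.iSup_mul]
  refine iSup_le fun k => (measure_lt_optValue_mul_le_measure_strictCone f (u k) hs).trans ?_
  gcongr
  intro g hg haux
  have haux' : auxValue m₁ m₂ ε₁ ε₅ f t g < ((u k - t : ℝ) : EReal) :=
    haux.trans_lt (EReal.coe_pos.2 (sub_pos.2 (htu k)))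
  obtain ⟨x, hx, hfx⟩ := exists_mem_strictCone_of_auxValue_lt hlt haux'
  exact (hg x hx).not_ge (by linarith)

theorem measure_le_optValue_mul_le (f : EuclideanSpace ℝ (Fin n) → ℝ) (t : ℝ) {ε₁ ε₅ s : ℝ}
    (hs : 0 ≤ s) (hlt : s < (1 + ε₁) * √((m₁ : ℝ) + (m₂ : ℝ) / 2) + ε₅ * √(n : ℝ)) :
    gaussianPair m₁ m₂ n {C | StrongDuality f (Matrix.of C.1) (Matrix.of C.2) ∧
        (t : EReal) ≤ optValue f (Matrix.of C.1) (Matrix.of C.2)} * gaussianReal 0 1 (Set.Ioi 0) ≤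
      gaussianVector n {g | auxValue m₁ m₂ ε₁ ε₅ f t g < 0}ᶜ +
        stdGaussianPi (Fin m₁ ⊕ Fin m₂) {h | s ^ 2 ≤ projSq h} := by
  obtain ⟨u, hu, hut, hlim⟩ := exists_seq_strictMono_tendsto t
  let Z : ℕ → Set (Fin n → ℝ) := fun k => {g | ∀ x ∈ strictCone s g, u k < f x}
  have hZ : Antitone Z := fun k k' hk g hg x hx => (hu.monotone hk).trans_lt (hg x hx)
  have hinter : ⋂ k, Z k ⊆ {g | auxValue m₁ m₂ ε₁ ε₅ f t g < 0}ᶜ := by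
    intro g hg haux
    obtain ⟨x, hx, hfx⟩ := exists_mem_strictCone_of_auxValue_lt (δ := 0) hlt haux
    rw [add_zero] at hfx
    obtain ⟨k, hk⟩ := (hlim.eventually_const_lt hfx).exists
    exact hk.not_gt (Set.mem_iInter.1 hg k x hx)
  refine le_trans ?_ (add_le_add_left (measure_mono hinter) _)
  have hmeas (k) : MeasurableSet (Z k) :=
    (isClosed_setOf_forall_mem_strictCone s fun x => u k < f x).measurableSet
  rw [hZ.measure_iInter (fun k => (hmeas k).nullMeasurableSet) ⟨0, measure_ne_top _ _⟩,
    ENNReal.iInf_add]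
  refine le_iInf fun k => le_trans ?_ (measure_lt_optValue_mul_le_measure_strictCone f (u k) hs)
  gcongr ?_ * _
  exact measure_mono fun C ⟨hSD, ht⟩ => ⟨hSD, (EReal.coe_lt_coe_iff.2 (hut k)).trans_le ht⟩

end FixedDimension

section Asymptotics

variable {α : Type*} {L : Filter α}

lemma WithOverwhelmingProbability.tendsto_measure_compl {Ω : ℕ → Type}
    [∀ n, MeasurableSpace (Ω n)] {P : ∀ n, Measure (Ω n)} {E : ∀ n, Set (Ω n)}
    (h : WithOverwhelmingProbability P E) : Tendsto (fun n => P n (E n)ᶜ) atTop (𝓝 0) := by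
  obtain ⟨c, hc, hle⟩ := h
  refine tendsto_of_tendsto_of_tendsto_of_le_of_le' tendsto_const_nhds ?_
    (Eventually.of_forall fun _ => zero_le) hle
  rw [← ENNReal.ofReal_zero]
  exact ENNReal.tendsto_ofReal (Real.tendsto_exp_neg_atTop_nhds_zero.comp
    (tendsto_natCast_atTop_atTop.const_mul_atTop hc))

lemma tendsto_measure_one_of_tendsto_compl {Ω : α → Type*} [∀ n, MeasurableSpace (Ω n)]
    {P : ∀ n, Measure (Ω n)} [∀ n, IsProbabilityMeasure (P n)] {E : ∀ n, Set (Ω n)}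
    (h : Tendsto (fun n => P n (E n)ᶜ) L (𝓝 0)) : Tendsto (fun n => P n (E n)) L (𝓝 1) := by
  have hlim : Tendsto (fun n => 1 - P n (E n)ᶜ) L (𝓝 1) := by
    simpa using ENNReal.Tendsto.sub tendsto_const_nhds h (Or.inl ENNReal.one_ne_top)
  refine tendsto_of_tendsto_of_tendsto_of_le_of_le hlim tendsto_const_nhds (fun n => ?_)
    fun n => prob_le_one
  rw [tsub_le_iff_right, ← measure_univ (μ := P n), ← Set.union_compl_self (E n)]
  exact measure_union_le _ _

lemma tendsto_measure_one_of_measure_inter_compl_mul_le {Ω : α → Type*}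
    [∀ n, MeasurableSpace (Ω n)] {P : ∀ n, Measure (Ω n)} [∀ n, IsProbabilityMeasure (P n)]
    {D E : ∀ n, Set (Ω n)} (hD : Tendsto (fun n => P n (D n)ᶜ) L (𝓝 0)) {c : ENNReal}
    (hc : c ≠ 0) (hc' : c ≠ ⊤) {b : α → ENNReal} (hb : Tendsto b L (𝓝 0))
    (hle : ∀ᶠ n in L, P n (D n ∩ (E n)ᶜ) * c ≤ b n) :
    Tendsto (fun n => P n (E n)) L (𝓝 1) := by
  refine tendsto_measure_one_of_tendsto_compl ?_
  have hlim : Tendsto (fun n => P n (D n)ᶜ + b n / c) L (𝓝 0) := by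
    simpa using hD.add (ENNReal.Tendsto.div_const hb (Or.inr hc))
  refine tendsto_of_tendsto_of_tendsto_of_le_of_le' tendsto_const_nhds hlim
    (Eventually.of_forall fun _ => zero_le) ?_
  filter_upwards [hle] with n hn
  calc P n (E n)ᶜ ≤ P n ((D n)ᶜ ∪ (D n ∩ (E n)ᶜ)) := by
        rw [Set.union_inter_distrib_left, Set.compl_union_self, Set.univ_inter]
        exact measure_mono Set.subset_union_right
    _ ≤ P n (D n)ᶜ + P n (D n ∩ (E n)ᶜ) := measure_union_le _ _
    _ ≤ P n (D n)ᶜ + b n / c := by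
        gcongr
        exact (ENNReal.le_div_iff_mul_le (Or.inl hc) (Or.inl hc')).2 hn

lemma gaussianReal_Ioi_ne_zero (μ : ℝ) {v : NNReal} (hv : v ≠ 0) (c : ℝ) :
    gaussianReal μ v (Set.Ioi c) ≠ 0 := by
  intro h
  have hvolume := gaussianReal_absolutelyContinuous' μ hv h
  simp at hvolume

lemma tendsto_measure_sq_le_projSq (m₁ m₂ : α → ℕ) {δ : α → ℝ} (hδ : Tendsto δ L atTop) :
    Tendsto (fun n => stdGaussianPi (Fin (m₁ n) ⊕ Fin (m₂ n))
      {h | (√((m₁ n : ℝ) + (m₂ n : ℝ) / 2) + δ n) ^ 2 ≤ projSq h}) L (𝓝 0) := by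
  set v := Var[fun t => t ^ 2; gaussianReal 0 1] + 2 * Var[fun t => (max t 0) ^ 2; gaussianReal 0 1]
  have hlim : Tendsto (fun n => ENNReal.ofReal (v / (4 * δ n ^ 2))) L (𝓝 0) := by
    rw [← ENNReal.ofReal_zero]
    exact ENNReal.tendsto_ofReal (Tendsto.const_div_atTop
      (((tendsto_pow_atTop two_ne_zero).comp hδ).const_mul_atTop (by norm_num)) v)
  refine tendsto_of_tendsto_of_tendsto_of_le_of_le' tendsto_const_nhds hlim
    (Eventually.of_forall fun _ => zero_le) ?_
  filter_upwards [hδ.eventually_gt_atTop 0] with n hn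
  simpa only [Fintype.card_fin] using measure_sq_le_projSq_le (ι₁ := Fin (m₁ n))
    (ι₂ := Fin (m₂ n)) hn

end Asymptotics

end RandomDuality

theorem mainTheorem2_general (m₁ m₂ : ℕ → ℕ) (f : ∀ n : ℕ, EuclideanSpace ℝ (Fin n) → ℝ)
    {ε₁ ε₅ : ℝ} (hε₁ : 0 ≤ ε₁) (hε₅ : 0 < ε₅) (ξD : ℕ → ℝ)
    (hdual : Tendsto (fun n => RandomDuality.gaussianPair (m₁ n) (m₂ n) n
      {C | RandomDuality.StrongDuality (f n) (Matrix.of C.1) (Matrix.of C.2)}ᶜ) atTop (𝓝 0)) :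
    (Tendsto (fun n => RandomDuality.gaussianVector n
        {g | RandomDuality.auxValue (m₁ n) (m₂ n) ε₁ ε₅ (f n) (ξD n) g ≤ 0}ᶜ) atTop (𝓝 0) →
      Tendsto (fun n => RandomDuality.gaussianPair (m₁ n) (m₂ n) n
        {C | RandomDuality.optValue (f n) (Matrix.of C.1) (Matrix.of C.2) ≤ (ξD n : EReal)})
        atTop (𝓝 1)) ∧
    (Tendsto (fun n => RandomDuality.gaussianVector n
        {g | RandomDuality.auxValue (m₁ n) (m₂ n) ε₁ ε₅ (f n) (ξD n) g < 0}ᶜ) atTop (𝓝 0) →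
      Tendsto (fun n => RandomDuality.gaussianPair (m₁ n) (m₂ n) n
        {C | RandomDuality.optValue (f n) (Matrix.of C.1) (Matrix.of C.2) < (ξD n : EReal)})
        atTop (𝓝 1)) := by
  let s (n : ℕ) : ℝ := √((m₁ n : ℝ) + (m₂ n : ℝ) / 2) + ε₅ / 2 * √(n : ℝ)
  have hs (n) : 0 ≤ s n := by positivity
  have hlt (n : ℕ) (hn : 0 < n) :
      s n < (1 + ε₁) * √((m₁ n : ℝ) + (m₂ n : ℝ) / 2) + ε₅ * √(n : ℝ) :=
    add_lt_add_of_le_of_lt (le_mul_of_one_le_left (Real.sqrt_nonneg _) (by linarith))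
      (mul_lt_mul_of_pos_right (half_lt_self hε₅) (Real.sqrt_pos.2 (Nat.cast_pos.2 hn)))
  have hh := RandomDuality.tendsto_measure_sq_le_projSq m₁ m₂
    ((Real.tendsto_sqrt_atTop.comp tendsto_natCast_atTop_atTop).const_mul_atTop (half_pos hε₅))
  constructor <;> intro hU <;>
    refine RandomDuality.tendsto_measure_one_of_measure_inter_compl_mul_le hdual
      (RandomDuality.gaussianReal_Ioi_ne_zero 0 one_ne_zero 0) (measure_ne_top _ _)
      (by simpa using hU.add hh) ?_ <;>
    filter_upwards [eventually_gt_atTop 0] with n hn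
  · simpa only [s, Set.ofPred_and, Set.compl_ofPred, not_le] using
      RandomDuality.measure_lt_optValue_mul_le (f n) (ξD n) (hs n) (hlt n hn)
  · simpa only [s, Set.ofPred_and, Set.compl_ofPred, not_lt] using
      RandomDuality.measure_le_optValue_mul_le (f n) (ξD n) (hs n) (hlt n hn)

theorem mainTheorem2
    (α₁ α₂ : ℝ) (m₁ m₂ : ℕ → ℕ)
    (hm₁ : Tendsto (fun n : ℕ => (m₁ n : ℝ) / n) atTop (𝓝 α₁))
    (hm₂ : Tendsto (fun n : ℕ => (m₂ n : ℝ) / n) atTop (𝓝 α₂))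
    (f : ∀ n : ℕ, EuclideanSpace ℝ (Fin n) → ℝ)
    (hfin : RandomDuality.WithOverwhelmingProbability
      (fun n => RandomDuality.gaussianPair (m₁ n) (m₂ n) n)
      (fun n => {C | RandomDuality.optValue (f n) (Matrix.of C.1) (Matrix.of C.2) ≠ ⊥ ∧
        RandomDuality.optValue (f n) (Matrix.of C.1) (Matrix.of C.2) ≠ ⊤}))
    (hdual : RandomDuality.WithOverwhelmingProbability
      (fun n => RandomDuality.gaussianPair (m₁ n) (m₂ n) n)
      (fun n => {C | RandomDuality.StrongDuality (f n) (Matrix.of C.1) (Matrix.of C.2)}))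
    (ε₁ ε₅ : ℝ) (hε₁ : 0 < ε₁) (hε₅ : 0 < ε₅)
    (ξD : ℕ → ℝ)
    (hξD : RandomDuality.WithOverwhelmingProbability
      (fun n => RandomDuality.gaussianVector n)
      (fun n => {g | RandomDuality.auxValue (m₁ n) (m₂ n) ε₁ ε₅ (f n) (ξD n) g ≤ 0})) :
    Tendsto (fun n => RandomDuality.gaussianPair (m₁ n) (m₂ n) n
        {C | RandomDuality.optValue (f n) (Matrix.of C.1) (Matrix.of C.2) ≤ (ξD n : EReal)}) atTop (𝓝 1) ∧
    (RandomDuality.WithOverwhelmingProbability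
        (fun n => RandomDuality.gaussianVector n)
        (fun n => {g | RandomDuality.auxValue (m₁ n) (m₂ n) ε₁ ε₅ (f n) (ξD n) g < 0}) →
      Tendsto (fun n => RandomDuality.gaussianPair (m₁ n) (m₂ n) n
        {C | RandomDuality.optValue (f n) (Matrix.of C.1) (Matrix.of C.2) < (ξD n : EReal)}) atTop (𝓝 1)) := by
  have h := mainTheorem2_general m₁ m₂ f hε₁.le hε₅ ξD hdual.tendsto_measure_compl
  exact ⟨h.1 hξD.tendsto_measure_compl, fun hneg => h.2 hneg.tendsto_measure_compl⟩
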